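/- All graphs are finite and simple. Cographs are defined recursively: $K_1$ is a cograph, and the disjoint union and the join of two cographs are cographs. Let $\delta(G)$ be the minimum degree and $\lambda(G)$ the edge-connectivity of $G$ (the least number of edges whose removal leaves a disconnected graph or a graph of order 1). A connected graph $G$ is super edge-connected if for every edge set $F\subseteq E(G)$ such that $G-F$ is disconnected and $|F|=\lambda(G)$ there is a vertex $v$ of degree $\delta(G)$ such that $F$ is the set of all edges incident with $v$; a disconnected graph is called super edge-connected if it has exactly one isolated vertex. Theorem. Let $T$ be a tree of order $m$. Every super edge-connected cograph $G$ with $\delta(G)\ge m+2$ contains a subtree $T'\cong T$ such that $G-V(T')$ is super edge-connected. The bound $m+2$ is tight in the following sense: for every even $m\ge 2$, with $T$ the star $K_{1,m-1}$ of order $m$, there is a super edge-connected cograph $G$ with $\delta(G)=m+1$ such that for no subtree $T'\cong T$ of $G$ is $G-V(T')$ super edge-connected. -/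

import Mathlib

universe u

/-- The join `G + H`: the disjoint union of `G` and `H` together with all edges between them. -/
def graphJoin {V W : Type u} (G : SimpleGraph V) (H : SimpleGraph W) : SimpleGraph (V ⊕ W) :=
  SimpleGraph.sum G H ⊔ completeBipartiteGraph V W

/-- Cographs: the least class of graphs, closed under isomorphism, which contains `K₁` and is
closed under disjoint union and join. -/
inductive IsCograph : ∀ {V : Type u}, SimpleGraph V → Prop
  | single : IsCograph (⊥ : SimpleGraph PUnit.{u + 1})
  | union {V W : Type u} {G : SimpleGraph V} {H : SimpleGraph W} :
      IsCograph G → IsCograph H → IsCograph (SimpleGraph.sum G H)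
  | join {V W : Type u} {G : SimpleGraph V} {H : SimpleGraph W} :
      IsCograph G → IsCograph H → IsCograph (graphJoin G H)
  | iso {V W : Type u} {G : SimpleGraph V} {H : SimpleGraph W} :
      G ≃g H → IsCograph G → IsCograph H

/-- An edge-cut: a set of edges of `G` whose removal leaves a disconnected graph. -/
def IsEdgeCut {V : Type u} (G : SimpleGraph V) (F : Set (Sym2 V)) : Prop :=
  F ⊆ G.edgeSet ∧ ¬ (G.deleteEdges F).Preconnected

/-- The edge-connectivity `λ(G)` of a finite graph: the least number of edges whose removal
results in a disconnected graph or a graph of order one. -/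
noncomputable def edgeConnectivity {V : Type u} (G : SimpleGraph V) : ℕ :=
  sInf {k | ∃ F : Set (Sym2 V), F ⊆ G.edgeSet ∧ F.ncard = k ∧
    (¬ (G.deleteEdges F).Preconnected ∨ Nat.card V = 1)}

open Classical in
/-- A finite graph `G` is super edge-connected if it is connected and every edge-cut with `λ(G)`
edges is the set of all edges at some vertex of degree `δ(G)`, or if it is disconnected and has
exactly one isolated vertex. -/
def IsSuperEdgeConnected {V : Type u} [Finite V] (G : SimpleGraph V) : Prop :=
  letI : Fintype V := Fintype.ofFinite V
  (G.Connected ∧ ∀ F : Set (Sym2 V), IsEdgeCut G F → F.ncard = edgeConnectivity G →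
      ∃ v : V, G.degree v = G.minDegree ∧ F = G.incidenceSet v) ∨
    (¬ G.Preconnected ∧ ∃! v : V, G.IsIsolated v)

/-- The star `K_{1,m-1}` on the vertex set `{0, …, m - 1}`, with centre `0`. -/
def starOfOrder (m : ℕ) : SimpleGraph (Fin m) :=
  SimpleGraph.fromRel fun i _ => i.val = 0

/-! In a graph of diameter at most two, every edge-cut contains all edges leaving some set X each of
whose vertices has a neighbour outside X. A vertex of X has at least δ + 1 - |X| such neighbours, so
the cut has at least δ edges, and equality leaves only |X| = 1, or |X| = δ with one outgoing edge
per vertex. Hence λ = δ, and the only obstruction to super edge-connectivity is a bad set: a clique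
of δ vertices of degree δ, each with a single neighbour outside (`DiamLeTwo.isSuperEdgeConnected`).

A connected cograph with more than one vertex is a join, so it remains to place T such that the rest
has diameter at most two and no bad set. If |V| ≤ m + 4, it suffices to spare a triangle
(`hasSuperRemoval_of_card_le`). If both sides of the join have at least two vertices, it suffices to
spare two on each side (`IsJoin.hasSuperRemoval`). Otherwise some z is universal. If G - z is a
join, z is moved to one of its sides. If G - z is disconnected, let K be its component containing a
vertex of minimum degree. As G is super edge-connected, K is not a clique, and T is placed inside K
so that the rest of K stays connected and non-complete and keeps a vertex of small degree. A bad set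
meeting K would then contain two non-adjacent vertices; one avoiding K would already be bad in G
(`hasSuperRemoval_of_cone`).

In the last two cases T minus a leaf is embedded greedily outside the spared vertices. If the parent
s of the leaf has no free neighbour left, the degree bound makes s adjacent to every spared vertex
(`adj_of_card_le`); one of them becomes the leaf and an unused vertex takes over its role.

For tightness, take the cone over two disjoint cocktail party graphs. A star through the apex leaves
a disconnected graph without isolated vertices; any other star lies in one cocktail party graph and
leaves two of its vertices, which form a bad set. -/

/-! ### Minimum edge-cuts in graphs of diameter at most two -/

section EdgeCuts

open Finset
open scoped Classical

universe v

variable {V : Type v} [Fintype V]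

/-- The neighbours of `x` as a finite set. -/
noncomputable def nbrs (G : SimpleGraph V) (x : V) : Finset V := univ.filter fun y => G.Adj x y

@[simp] lemma mem_nbrs {G : SimpleGraph V} {x y : V} : y ∈ nbrs G x ↔ G.Adj x y := by
  simp [nbrs]

lemma card_nbrs (G : SimpleGraph V) (x : V) [Fintype (G.neighborSet x)] :
    (nbrs G x).card = G.degree x := by
  rw [← SimpleGraph.card_neighborFinset_eq_degree]
  congr 1
  ext y
  simp

lemma minDegree_le_card_nbrs (G : SimpleGraph V) [DecidableRel G.Adj] (x : V) :
    G.minDegree ≤ (nbrs G x).card := by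
  rw [card_nbrs]
  exact G.minDegree_le_degree x

lemma exists_card_nbrs_eq_minDegree (G : SimpleGraph V) [DecidableRel G.Adj] [Nonempty V] :
    ∃ v, (nbrs G v).card = G.minDegree := by
  obtain ⟨v, hv⟩ := G.exists_minimal_degree_vertex
  exact ⟨v, by rw [card_nbrs, hv]⟩

lemma ncard_incidenceSet (G : SimpleGraph V) (v : V) :
    (G.incidenceSet v).ncard = (nbrs G v).card := by
  rw [card_nbrs, ← G.card_incidenceSet_eq_degree, Set.ncard_eq_toFinset_card', Set.toFinset_card]

/-- Any two distinct non-adjacent vertices have a common neighbour. -/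
def DiamLeTwo {V : Type*} (G : SimpleGraph V) : Prop :=
  ∀ x y, x ≠ y → ¬ G.Adj x y → ∃ c, G.Adj x c ∧ G.Adj c y

lemma DiamLeTwo.preconnected {V : Type*} {G : SimpleGraph V} (h : DiamLeTwo G) :
    G.Preconnected := by
  intro x y
  by_cases hxy : x = y
  · subst hxy; rfl
  by_cases ha : G.Adj x y
  · exact ha.reachable
  · obtain ⟨c, h1, h2⟩ := h x y hxy ha
    exact h1.reachable.trans h2.reachable

lemma not_preconnected_of_closed {V : Type*} {G : SimpleGraph V} {X : Set V} {a b : V}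
    (h : ∀ x ∈ X, ∀ y, G.Adj x y → y ∈ X) (ha : a ∈ X) (hb : b ∉ X) : ¬ G.Preconnected := by
  intro hc
  obtain ⟨p⟩ := hc a b
  have : ∀ {x y : V}, G.Walk x y → x ∈ X → y ∈ X := by
    intro x y p
    induction p with
    | nil => exact id
    | cons hxy _ ih => exact fun hx => ih (h _ hx _ hxy)
  exact hb (this p ha)

/-- The edges of `G` between `X` and its complement. -/
noncomputable def cutEdges (G : SimpleGraph V) (X : Finset V) : Finset (Sym2 V) :=
  (X.sigma fun x => nbrs G x \ X).image fun p => s(p.1, p.2)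

lemma mem_cutEdges {G : SimpleGraph V} {X : Finset V} {e : Sym2 V} :
    e ∈ cutEdges G X ↔ ∃ x ∈ X, ∃ y, y ∉ X ∧ G.Adj x y ∧ e = s(x, y) := by
  simp only [cutEdges, mem_image, mem_sigma, mem_sdiff, mem_nbrs, Sigma.exists]
  constructor
  · rintro ⟨x, y, ⟨hx, hxy, hy⟩, rfl⟩
    exact ⟨x, hx, y, hy, hxy, rfl⟩
  · rintro ⟨x, hx, y, hy, hxy, rfl⟩
    exact ⟨x, y, ⟨hx, hxy, hy⟩, rfl⟩

lemma card_cutEdges (G : SimpleGraph V) (X : Finset V) :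
    (cutEdges G X).card = ∑ x ∈ X, (nbrs G x \ X).card := by
  rw [cutEdges, card_image_of_injOn, card_sigma]
  rintro ⟨x, y⟩ hp ⟨x', y'⟩ hq h
  simp only [coe_sigma, Set.mem_sigma_iff, mem_coe, mem_sdiff, mem_nbrs] at hp hq
  simp only [Sym2.eq_iff] at h
  rcases h with ⟨rfl, rfl⟩ | ⟨rfl, rfl⟩
  · rfl
  · exact absurd hq.1 hp.2.2

lemma cutEdges_compl (G : SimpleGraph V) (X : Finset V) : cutEdges G Xᶜ = cutEdges G X := by
  ext e
  simp only [mem_cutEdges, mem_compl, not_not]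
  constructor
  · rintro ⟨x, hx, y, hy, hxy, rfl⟩
    exact ⟨y, hy, x, hx, hxy.symm, Sym2.eq_swap⟩
  · rintro ⟨x, hx, y, hy, hxy, rfl⟩
    exact ⟨y, hy, x, hx, hxy.symm, Sym2.eq_swap⟩

lemma cutEdges_subset_edgeSet (G : SimpleGraph V) (X : Finset V) :
    (cutEdges G X : Set (Sym2 V)) ⊆ G.edgeSet := by
  intro e he
  obtain ⟨x, -, y, -, hxy, rfl⟩ := mem_cutEdges.1 he
  exact hxy

lemma not_preconnected_deleteEdges_cutEdges {G : SimpleGraph V} {X : Finset V} {a b : V}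
    (ha : a ∈ X) (hb : b ∉ X) : ¬ (G.deleteEdges (cutEdges G X)).Preconnected := by
  refine not_preconnected_of_closed (X := X) (fun x hx y hxy => ?_) ha hb
  rw [SimpleGraph.deleteEdges_adj] at hxy
  by_contra hy
  exact hxy.2 (mem_cutEdges.2 ⟨x, hx, y, hy, hxy.1, rfl⟩)

lemma exists_cutEdges_subset {G : SimpleGraph V} {F : Set (Sym2 V)}
    (hF : ¬ (G.deleteEdges F).Preconnected) :
    ∃ X : Finset V, X.Nonempty ∧ Xᶜ.Nonempty ∧ (cutEdges G X : Set (Sym2 V)) ⊆ F := by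
  simp only [SimpleGraph.Preconnected, not_forall] at hF
  obtain ⟨u, v, huv⟩ := hF
  refine ⟨univ.filter fun x => (G.deleteEdges F).Reachable u x, ⟨u, by simp⟩,
    ⟨v, by simpa using huv⟩, ?_⟩
  intro e he
  obtain ⟨x, hx, y, hy, hxy, rfl⟩ := mem_cutEdges.1 he
  simp only [mem_filter, mem_univ, true_and] at hx hy
  by_contra hf
  refine hy (hx.trans (SimpleGraph.Adj.reachable ?_))
  rw [SimpleGraph.deleteEdges_adj]
  exact ⟨hxy, hf⟩

lemma cutEdges_singleton (G : SimpleGraph V) (v : V) :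
    (cutEdges G {v} : Set (Sym2 V)) = G.incidenceSet v := by
  ext e
  rw [mem_coe, mem_cutEdges]
  constructor
  · rintro ⟨x, hx, y, hy, hxy, rfl⟩
    rw [mem_singleton] at hx
    subst hx
    exact ⟨hxy, Sym2.mem_mk_left _ _⟩
  · rintro ⟨he, hv⟩
    obtain ⟨y, rfl⟩ := Sym2.mem_iff_exists.1 hv
    have hadj : G.Adj v y := he
    exact ⟨v, mem_singleton_self v, y, by simpa using hadj.ne', hadj, rfl⟩

lemma card_nbrs_le (G : SimpleGraph V) {X : Finset V} {x : V} (hx : x ∈ X) :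
    (nbrs G x).card + 1 ≤ (nbrs G x \ X).card + X.card := by
  have h1 : (nbrs G x ∩ X).card + 1 ≤ X.card := by
    have : nbrs G x ∩ X ⊆ X.erase x := by
      intro y hy
      rw [mem_inter, mem_nbrs] at hy
      exact mem_erase.2 ⟨hy.1.ne', hy.2⟩
    have h2 := card_le_card this
    rw [card_erase_of_mem hx] at h2
    have := card_pos.2 ⟨x, hx⟩
    omega
  have h3 := card_sdiff_add_card_inter (nbrs G x) X
  omega

/-- If every vertex of `X` has a neighbour outside of `X`, then at least `k` edges leave `X` when
`k` bounds the degrees from below; the cases of equality. -/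
lemma le_card_cutEdges {G : SimpleGraph V} {k : ℕ} (hk : ∀ v, k ≤ (nbrs G v).card) {X : Finset V}
    (hX : X.Nonempty) (hout : ∀ x ∈ X, (nbrs G x \ X).Nonempty) :
    k ≤ (cutEdges G X).card ∧ ((cutEdges G X).card = k →
      X.card = 1 ∨ (X.card = k ∧ ∀ x ∈ X, (nbrs G x \ X).card = 1)) := by
  rw [card_cutEdges]
  have hpos := card_pos.2 hX
  have h1 : ∀ x ∈ X, 1 ≤ (nbrs G x \ X).card := fun x hx => card_pos.2 (hout x hx)
  have h2 : X.card ≤ ∑ x ∈ X, (nbrs G x \ X).card := by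
    simpa using card_nsmul_le_sum X _ 1 h1
  have h3 : X.card * (k + 1 - X.card) ≤ ∑ x ∈ X, (nbrs G x \ X).card := by
    simpa using card_nsmul_le_sum X (fun x => (nbrs G x \ X).card) (k + 1 - X.card) (fun x hx => by
      have := card_nbrs_le G hx
      have := hk x
      omega)
  by_cases hkX : k < X.card
  · exact ⟨by omega, fun h => by omega⟩
  · push Not at hkX
    obtain ⟨a, ha⟩ := Nat.exists_eq_add_of_le hkX
    obtain ⟨b, hb⟩ := Nat.exists_eq_add_of_le' hpos
    have hka : k + 1 - X.card = a + 1 := by omega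
    rw [hka] at h3
    -- With |X| = b + 1 and k = |X| + a, the excess over `k` is b * a, so equality means |X| = 1 or
    -- |X| = k.
    have h4 : X.card * (a + 1) = k + b * a := by rw [ha, hb]; ring
    refine ⟨by omega, fun h => ?_⟩
    have h5 : b * a = 0 := by omega
    rcases Nat.mul_eq_zero.1 h5 with h6 | h6
    · left; omega
    · right
      refine ⟨by omega, fun x hx => ?_⟩
      have h7 : ∑ x ∈ X, 1 = ∑ x ∈ X, (nbrs G x \ X).card := by
        rw [h]; simp; omega
      exact ((sum_eq_sum_iff_of_le h1).1 h7 x hx).symm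

/-- A vertex of X with no neighbour outside and a vertex outside with no neighbour in X would be at
distance at least three. -/
lemma DiamLeTwo.exists_side {G : SimpleGraph V} (hG : DiamLeTwo G) (X : Finset V) :
    (∀ x ∈ X, (nbrs G x \ X).Nonempty) ∨ (∀ x ∈ Xᶜ, (nbrs G x \ Xᶜ).Nonempty) := by
  by_contra! h
  obtain ⟨⟨x, hx, hx'⟩, ⟨y, hy, hy'⟩⟩ := h
  have hx2 : ∀ c, G.Adj x c → c ∈ X := fun c hc => by
    by_contra h
    have : c ∈ nbrs G x \ X := by simp [hc, h]
    simp [hx'] at this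
  have hy2 : ∀ c, G.Adj y c → c ∉ X := fun c hc h => by
    have : c ∈ nbrs G y \ Xᶜ := by simp [hc, h]
    simp [hy'] at this
  rw [mem_compl] at hy
  obtain ⟨c, h1, h2⟩ := hG x y (fun h => hy (h ▸ hx)) (fun h => hy (hx2 y h))
  exact hy2 c h2.symm (hx2 c h1)

lemma DiamLeTwo.le_ncard {G : SimpleGraph V} (hG : DiamLeTwo G) {k : ℕ}
    (hk : ∀ v, k ≤ (nbrs G v).card) {F : Set (Sym2 V)} (hF : ¬ (G.deleteEdges F).Preconnected) :
    k ≤ F.ncard ∧ (F.ncard = k → ∃ X : Finset V, X.Nonempty ∧ Xᶜ.Nonempty ∧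
      (cutEdges G X : Set (Sym2 V)) = F ∧
      (X.card = 1 ∨ (X.card = k ∧ ∀ x ∈ X, (nbrs G x \ X).card = 1))) := by
  obtain ⟨X, hX, hXc, hXF, hout⟩ : ∃ X : Finset V, X.Nonempty ∧ Xᶜ.Nonempty ∧
      (cutEdges G X : Set (Sym2 V)) ⊆ F ∧ ∀ x ∈ X, (nbrs G x \ X).Nonempty := by
    obtain ⟨X, hX, hXc, hXF⟩ := exists_cutEdges_subset hF
    rcases hG.exists_side X with h | h
    · exact ⟨X, hX, hXc, hXF, h⟩
    · exact ⟨Xᶜ, hXc, by simpa using hX, by rwa [cutEdges_compl], h⟩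
  have hle := le_card_cutEdges hk hX hout
  have h1 := Set.ncard_le_ncard hXF (Set.toFinite F)
  rw [Set.ncard_coe_finset] at h1
  refine ⟨hle.1.trans h1, fun h => ⟨X, hX, hXc, ?_, hle.2 (by omega)⟩⟩
  refine Set.eq_of_subset_of_ncard_le hXF ?_ (Set.toFinite F)
  rw [Set.ncard_coe_finset]
  omega

lemma DiamLeTwo.edgeConnectivity_eq {G : SimpleGraph V} (hG : DiamLeTwo G) {v : V}
    (hv : ∀ u, (nbrs G v).card ≤ (nbrs G u).card) : edgeConnectivity G = (nbrs G v).card := by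
  refine le_antisymm (Nat.sInf_le ⟨G.incidenceSet v, fun e he => he.1, ncard_incidenceSet G v, ?_⟩)
    (le_csInf ⟨_, G.incidenceSet v, fun e he => he.1, rfl, ?_⟩ ?_)
  -- The first two goals both ask that deleting the star at `v` be admissible: it isolates `v`,
  -- unless `v` is the only vertex.
  all_goals try
    by_cases hu : ∃ u, u ≠ v
    · obtain ⟨u, hu⟩ := hu
      left
      rw [← cutEdges_singleton]
      exact not_preconnected_deleteEdges_cutEdges (mem_singleton_self v) (by simpa using hu)
    · right
      push Not at hu
      rw [Nat.card_eq_one_iff_unique]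
      exact ⟨⟨fun a b => (hu a).trans (hu b).symm⟩, ⟨v⟩⟩
  rintro k ⟨F, -, rfl, h | h⟩
  · exact (hG.le_ncard hv h).1
  · have := (Nat.card_eq_one_iff_unique.1 h).1
    have h0 : nbrs G v = ∅ := by
      ext y
      simp [Subsingleton.elim y v]
    simp [h0]

/-- Replaces degrees by `nbrs`, so that the `Fintype` instance chosen inside `IsSuperEdgeConnected`
no longer matters. -/
lemma isSuperEdgeConnected_iff (G : SimpleGraph V) :
    IsSuperEdgeConnected G ↔ (G.Connected ∧ ∀ F : Set (Sym2 V), IsEdgeCut G F →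
      F.ncard = edgeConnectivity G →
      ∃ v : V, (∀ u, (nbrs G v).card ≤ (nbrs G u).card) ∧ F = G.incidenceSet v) ∨
    (¬ G.Preconnected ∧ ∃! v : V, G.IsIsolated v) := by
  have key : ∀ v : V, (let _ : Fintype V := Fintype.ofFinite V; G.degree v = G.minDegree) ↔
      ∀ u, (nbrs G v).card ≤ (nbrs G u).card := by
    intro v
    -- Stated before `i` is introduced, so that `nbrs` refers to the ambient instance.
    have e := fun u (_ : Fintype (G.neighborSet u)) => card_nbrs G u
    let i : Fintype V := Fintype.ofFinite V
    constructor
    · intro h u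
      rw [e u inferInstance, e v inferInstance]
      exact h.le.trans (G.minDegree_le_degree u)
    · intro h
      have : Nonempty V := ⟨v⟩
      refine le_antisymm (G.le_minDegree_of_forall_le_degree _ fun u => ?_)
        (G.minDegree_le_degree v)
      have := h u
      rwa [e u inferInstance, e v inferInstance] at this
  unfold IsSuperEdgeConnected
  refine or_congr (and_congr_right fun _ => forall_congr' fun F => imp_congr_right fun _ =>
    imp_congr_right fun _ => exists_congr fun v => and_congr (key v) Iff.rfl) Iff.rfl

/-- The vertex sets which give minimum edge-cuts other than the trivial ones in graphs of
diameter at most two. -/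
structure IsBadSet (G : SimpleGraph V) (X : Finset V) : Prop where
  two_le : 2 ≤ X.card
  two_le_compl : 2 ≤ Xᶜ.card
  le_card_nbrs : ∀ v, X.card ≤ (nbrs G v).card
  card_nbrs_eq : ∀ x ∈ X, (nbrs G x).card = X.card
  adj : ∀ x ∈ X, ∀ y ∈ X, x ≠ y → G.Adj x y
  card_out : ∀ x ∈ X, (nbrs G x \ X).card = 1

/-- A minimum cut that is not a star has a side of δ vertices with one outgoing edge each. Every
vertex there needs δ - 1 neighbours inside, so that side is a clique and a bad set. -/
lemma DiamLeTwo.isSuperEdgeConnected [Nonempty V] {G : SimpleGraph V} (hG : DiamLeTwo G)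
    (hbad : ∀ X, ¬ IsBadSet G X) : IsSuperEdgeConnected G := by
  rw [isSuperEdgeConnected_iff]
  left
  refine ⟨⟨hG.preconnected⟩, fun F hF hcard => ?_⟩
  obtain ⟨v, -, hv⟩ := exists_min_image univ (fun u => (nbrs G u).card) univ_nonempty
  replace hv : ∀ u, (nbrs G v).card ≤ (nbrs G u).card := fun u => hv u (mem_univ u)
  rw [hG.edgeConnectivity_eq hv] at hcard
  have star : ∀ w : V, F = G.incidenceSet w → ∃ w : V, (∀ u, (nbrs G w).card ≤ (nbrs G u).card) ∧
      F = G.incidenceSet w := by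
    intro w hw
    refine ⟨w, fun u => ?_, hw⟩
    rw [← ncard_incidenceSet, ← hw, hcard]
    exact hv u
  obtain ⟨X, hX, hXc, hXF, hX1 | ⟨hXk, hX1⟩⟩ := (hG.le_ncard hv hF.2).2 hcard
  · obtain ⟨w, rfl⟩ := card_eq_one.1 hX1
    exact star w (by rw [← hXF, cutEdges_singleton])
  by_cases hX2 : X.card = 1
  · obtain ⟨w, rfl⟩ := card_eq_one.1 hX2
    exact star w (by rw [← hXF, cutEdges_singleton])
  by_cases hXc2 : Xᶜ.card = 1
  · obtain ⟨w, hw⟩ := card_eq_one.1 hXc2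
    exact star w (by rw [← hXF, ← cutEdges_compl, hw, cutEdges_singleton])
  have hXpos := card_pos.2 hX
  have hXcpos := card_pos.2 hXc
  refine absurd ⟨by omega, by omega, fun u => hXk ▸ hv u, fun x hx => ?_, fun x hx y hy hxy => ?_,
    hX1⟩ (hbad X)
  · have := card_nbrs_le G hx
    have := hX1 x hx
    have := hv x
    omega
  · by_contra hadj
    have h1 : nbrs G x ∩ X ⊆ (X.erase x).erase y := by
      intro u hu
      rw [mem_inter, mem_nbrs] at hu
      refine mem_erase.2 ⟨fun h => hadj (h ▸ hu.1), mem_erase.2 ⟨hu.1.ne', hu.2⟩⟩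
    have h2 := card_le_card h1
    rw [card_erase_of_mem (mem_erase.2 ⟨hxy.symm, hy⟩), card_erase_of_mem hx] at h2
    have h3 := card_sdiff_add_card_inter (nbrs G x) X
    have := hX1 x hx
    have := hv x
    omega

lemma diamLeTwo_of_universal {V : Type*} {G : SimpleGraph V} {z : V}
    (hz : ∀ v, v ≠ z → G.Adj z v) : DiamLeTwo G := by
  intro x y hxy hn
  refine ⟨z, (hz x ?_).symm, hz y ?_⟩
  · rintro rfl; exact hn (hz y hxy.symm)
  · rintro rfl; exact hn (hz x hxy).symm

/-- The edges from X to z form a cut of size |X|, and the vertices of X have degree |X|, so this cut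
is minimum. As |X| ≥ 2 it could only be the star at z, but the edge zw is not in it. -/
lemma not_isSuperEdgeConnected_of_universal {G : SimpleGraph V} {z w : V}
    (hz : ∀ v, v ≠ z → G.Adj z v) {X : Finset V} (hzX : z ∉ X)
    (hX : ∀ x ∈ X, ∀ y, G.Adj x y → y ∈ X ∨ y = z) (hwX : w ∉ X) (hwz : w ≠ z)
    (hX2 : 2 ≤ X.card) (hdeg : ∀ v, X.card ≤ (nbrs G v).card) : ¬ IsSuperEdgeConnected G := by
  have hG := diamLeTwo_of_universal hz
  have hout : ∀ x ∈ X, nbrs G x \ X = {z} := by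
    intro x hx
    ext y
    rw [mem_sdiff, mem_nbrs, mem_singleton]
    constructor
    · rintro ⟨h1, h2⟩
      exact (hX x hx y h1).resolve_left h2
    · rintro rfl
      exact ⟨(hz x (fun h => hzX (h ▸ hx))).symm, hzX⟩
  obtain ⟨a, ha, b, hb, hab⟩ := one_lt_card.1 hX2
  have hcard : (cutEdges G X).card = X.card := by
    rw [card_cutEdges, sum_congr rfl fun x hx => by rw [hout x hx]]
    simp
  have haz : a ≠ z := fun h => hzX (h ▸ ha)
  have hbz : b ≠ z := fun h => hzX (h ▸ hb)
  have hda : (nbrs G a).card = X.card := by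
    have h1 := card_nbrs_le G ha
    have h2 := hdeg a
    rw [hout a ha, card_singleton] at h1
    omega
  have hlam : edgeConnectivity G = X.card := by
    rw [hG.edgeConnectivity_eq (v := a) (fun u => hda ▸ hdeg u), hda]
  rw [isSuperEdgeConnected_iff]
  rintro (⟨-, h⟩ | ⟨h, -⟩)
  · obtain ⟨v, -, hv⟩ := h (cutEdges G X) ⟨cutEdges_subset_edgeSet G X,
      not_preconnected_deleteEdges_cutEdges ha hwX⟩ (by rw [Set.ncard_coe_finset, hcard, hlam])
    have key : ∀ x ∈ X, v = x ∨ v = z := by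
      intro x hx
      have h1 : s(x, z) ∈ (cutEdges G X : Set (Sym2 V)) :=
        mem_cutEdges.2 ⟨x, hx, z, hzX, (hz x (fun h => hzX (h ▸ hx))).symm, rfl⟩
      rw [hv] at h1
      exact Sym2.mem_iff.1 h1.2
    have hvz : v = z := by
      rcases key a ha with h1 | h1
      · rcases key b hb with h2 | h2
        · exact absurd (h1.symm.trans h2) hab
        · exact h2
      · exact h1
    have h2 : s(z, w) ∈ G.incidenceSet v := ⟨hz w hwz, by simp [hvz]⟩
    rw [← hv] at h2
    obtain ⟨x, hx, y, hy, -, he⟩ := mem_cutEdges.1 h2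
    rcases Sym2.eq_iff.1 he with ⟨h3, h4⟩ | ⟨h3, h4⟩
    · exact hzX (h3 ▸ hx)
    · exact hwX (h4 ▸ hx)
  · exact h hG.preconnected

/-- The criterion for super edge-connectivity of the graph left after deleting `P`. -/
lemma isSuperEdgeConnected_induce {G : SimpleGraph V} {R : Set V} {P : Finset V}
    (hR : ∀ v, v ∈ R ↔ v ∉ P) {a : V} (ha : a ∉ P)
    (hdiam : ∀ x y, x ∉ P → y ∉ P → x ≠ y → ¬ G.Adj x y → ∃ c, c ∉ P ∧ G.Adj x c ∧ G.Adj c y)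
    (hbad : ∀ X : Finset V, Disjoint X P → 2 ≤ X.card → 2 ≤ (Pᶜ \ X).card →
      (∀ v, v ∉ P → X.card ≤ (nbrs G v \ P).card) →
      (∀ x ∈ X, (nbrs G x \ P).card = X.card) →
      (∀ x ∈ X, ∀ y ∈ X, x ≠ y → G.Adj x y) →
      (∀ x ∈ X, ((nbrs G x \ P) \ X).card = 1) → False) :
    IsSuperEdgeConnected (G.induce R) := by
  have : Nonempty R := ⟨⟨a, (hR a).2 ha⟩⟩
  let ι : R ↪ V := Function.Embedding.subtype _
  have hmapN : ∀ x : R, (nbrs (G.induce R) x).map ι = nbrs G x \ P := by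
    intro x
    ext y
    simp only [mem_map, mem_nbrs, SimpleGraph.comap_adj, mem_sdiff, ι,
      Function.Embedding.subtype_apply]
    constructor
    · rintro ⟨y, h, rfl⟩
      exact ⟨h, (hR y).1 y.2⟩
    · rintro ⟨h1, h2⟩
      exact ⟨⟨y, (hR y).2 h2⟩, h1, rfl⟩
  have hcardN : ∀ x : R, (nbrs (G.induce R) x).card = (nbrs G x \ P).card := fun x => by
    rw [← hmapN, card_map]
  refine DiamLeTwo.isSuperEdgeConnected ?_ ?_
  · rintro ⟨x, hx⟩ ⟨y, hy⟩ hxy hadj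
    obtain ⟨c, hc, h1, h2⟩ := hdiam x y ((hR x).1 hx) ((hR y).1 hy)
      (fun h => hxy (Subtype.ext h)) hadj
    exact ⟨⟨c, (hR c).2 hc⟩, h1, h2⟩
  · intro X hX
    have hcompl : (Xᶜ).map ι = Pᶜ \ X.map ι := by
      ext y
      simp only [mem_map, mem_compl, mem_sdiff, ι, Function.Embedding.subtype_apply]
      constructor
      · rintro ⟨y, h, rfl⟩
        exact ⟨(hR y).1 y.2, fun ⟨y', h', e⟩ => h (Subtype.ext e ▸ h')⟩
      · rintro ⟨h1, h2⟩
        exact ⟨⟨y, (hR y).2 h1⟩, fun h => h2 ⟨_, h, rfl⟩, rfl⟩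
    have hmem : ∀ x ∈ X.map ι, ∃ h : x ∈ R, (⟨x, h⟩ : R) ∈ X := by
      intro x hx
      obtain ⟨x, hx', rfl⟩ := mem_map.1 hx
      exact ⟨x.2, hx'⟩
    refine hbad (X.map ι) ?_ (by rw [card_map]; exact hX.two_le) ?_ ?_ ?_ ?_ ?_
    · rw [disjoint_left]
      intro x hx
      obtain ⟨h, -⟩ := hmem x hx
      exact (hR x).1 h
    · rw [← hcompl, card_map]; convert hX.two_le_compl
    · intro v hv
      rw [card_map, ← hcardN ⟨v, (hR v).2 hv⟩]
      exact hX.le_card_nbrs _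
    · intro x hx
      obtain ⟨h, hx⟩ := hmem x hx
      rw [card_map, ← hcardN ⟨x, h⟩]
      exact hX.card_nbrs_eq _ hx
    · intro x hx y hy hxy
      obtain ⟨h, hx⟩ := hmem x hx
      obtain ⟨h', hy⟩ := hmem y hy
      exact hX.adj _ hx _ hy fun e => hxy (congrArg Subtype.val e)
    · intro x hx
      obtain ⟨h, hx⟩ := hmem x hx
      rw [← hmapN ⟨x, h⟩, ← Finset.map_sdiff, card_map]
      convert hX.card_out _ hx

end EdgeCuts

/-! ### Greedy embedding of trees -/

section TreeCopies

open Finset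
open scoped Classical

universe v w

variable {V : Type v} {W : Type w}

/-- `T` has a copy in `G` with vertex set `P`. -/
def CopyOn (T : SimpleGraph W) (G : SimpleGraph V) (P : Finset V) : Prop :=
  ∃ f : SimpleGraph.Copy T G, Set.range f = P

lemma CopyOn.exists_subgraph {T : SimpleGraph W} {G : SimpleGraph V} {P : Finset V}
    (h : CopyOn T G P) : ∃ T' : G.Subgraph, Nonempty (T'.coe ≃g T) ∧ T'.verts = P := by
  obtain ⟨f, hf⟩ := h
  refine ⟨f.toSubgraph, ⟨f.isoToSubgraph.symm⟩, ?_⟩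
  rw [← hf]
  simp

lemma copyOn_singleton {T : SimpleGraph W} (G : SimpleGraph V) [Nonempty W] [Subsingleton W]
    (y : V) : CopyOn T G {y} := by
  refine ⟨⟨⟨fun _ => y, fun {a b} h => ?_⟩, fun a b _ => Subsingleton.elim a b⟩, ?_⟩
  · exact absurd (Subsingleton.elim a b) h.ne
  · rw [coe_singleton]
    exact Set.range_const

/-- A copy of a tree without a leaf extends to the tree by a suitable neighbour. -/
lemma CopyOn.exists_extend {T : SimpleGraph W} {G : SimpleGraph V} {l r : W} (hr : T.Adj l r)
    (hl : ∀ w, T.Adj l w → w = r) {P : Finset V} (h : CopyOn (T.induce {l}ᶜ) G P) :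
    ∃ s ∈ P, ∀ y ∉ P, G.Adj s y → CopyOn T G (insert y P) := by
  obtain ⟨f, hf⟩ := h
  have hfP : ∀ a, f a ∈ P := fun a => by
    rw [← mem_coe, ← hf]
    exact Set.mem_range_self a
  refine ⟨f ⟨r, hr.ne'⟩, hfP _, fun y hy hsy => ?_⟩
  let g : W → V := fun w => if h : w = l then y else f ⟨w, h⟩
  have gl : g l = y := dif_pos rfl
  have gne : ∀ w (h : w ≠ l), g w = f ⟨w, h⟩ := fun w h => dif_neg h
  have glw : ∀ w, T.Adj l w → G.Adj (g l) (g w) := by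
    intro w hw
    obtain rfl := hl w hw
    rw [gl, gne w hw.ne']
    exact hsy.symm
  refine ⟨⟨⟨g, fun {a b} hab => ?_⟩, fun a b hab => ?_⟩, ?_⟩
  · by_cases ha : a = l
    · subst ha
      exact glw b hab
    · by_cases hb : b = l
      · subst hb
        exact (glw a hab.symm).symm
      · rw [gne a ha, gne b hb]
        exact f.toHom.map_adj hab
  · replace hab : g a = g b := hab
    by_cases ha : a = l
    · by_cases hb : b = l
      · rw [ha, hb]
      · rw [ha, gl, gne b hb] at hab
        exact absurd (hab ▸ hfP _) hy
    · by_cases hb : b = l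
      · rw [hb, gl, gne a ha] at hab
        exact absurd (hab ▸ hfP _) hy
      · rw [gne a ha, gne b hb] at hab
        exact congrArg Subtype.val (f.injective hab)
  · change Set.range g = _
    rw [coe_insert, ← hf]
    ext x
    simp only [Set.mem_range, Set.mem_insert_iff]
    constructor
    · rintro ⟨w, rfl⟩
      by_cases hw : w = l
      · left; rw [hw, gl]
      · right; exact ⟨⟨w, hw⟩, (gne w hw).symm⟩
    · rintro (rfl | ⟨w, rfl⟩)
      · exact ⟨l, gl⟩
      · exact ⟨w, gne w w.2⟩

/-- `P` is the vertex set of a copy of `T` without some vertex, which extends to a copy of `T`. -/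
def ExtendsToCopy (T : SimpleGraph W) (G : SimpleGraph V) (P : Finset V) : Prop :=
  (P = ∅ ∧ ∀ y, CopyOn T G {y}) ∨ ∃ s ∈ P, ∀ y ∉ P, G.Adj s y → CopyOn T G (insert y P)

/-- The vertex s has at least |P| neighbours in S, and at most |P| - 1 of them lie in P. -/
lemma ExtendsToCopy.exists_copyOn [Fintype V] {T : SimpleGraph W} {G : SimpleGraph V}
    {P S : Finset V} (hP : ExtendsToCopy T G P) (hPS : P ⊆ S) (hS : S.Nonempty)
    (hdeg : ∀ y ∈ S, P.card ≤ (nbrs G y ∩ S).card) :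
    ∃ Q ⊆ S, Q.card = P.card + 1 ∧ CopyOn T G Q := by
  rcases hP with ⟨rfl, h⟩ | ⟨s, hs, h⟩
  · obtain ⟨y, hy⟩ := hS
    exact ⟨{y}, by simpa using hy, by simp, h y⟩
  · obtain ⟨y, hy, hyP⟩ : ∃ y ∈ nbrs G s ∩ S, y ∉ P := by
      by_contra! hc
      have h1 : nbrs G s ∩ S ⊆ P.erase s := fun y hy =>
        mem_erase.2 ⟨(mem_nbrs.1 (mem_inter.1 hy).1).ne', hc y hy⟩
      have h2 := card_le_card h1
      rw [card_erase_of_mem hs] at h2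
      have h3 := hdeg s (hPS hs)
      have := card_pos.2 ⟨s, hs⟩
      omega
    rw [mem_inter, mem_nbrs] at hy
    exact ⟨insert y P, insert_subset hy.2 hPS, card_insert_of_notMem hyP, h y hyP hy.1⟩

/-- Induction by removing leaves. Stopping one leaf short needs degree only n - 1 inside S, one less
than the whole tree needs; this slack allows more vertices to be spared. -/
lemma exists_extendsToCopy [Fintype V] (G : SimpleGraph V) {S : Finset V} (hS : S.Nonempty)
    (n : ℕ) : ∀ {W : Type w} [Fintype W] (T : SimpleGraph W), T.IsTree → Fintype.card W = n + 1 →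
      (∀ y ∈ S, n ≤ (nbrs G y ∩ S).card + 1) → ∃ P ⊆ S, P.card = n ∧ ExtendsToCopy T G P := by
  induction n with
  | zero =>
    intro W _ T hT hW _
    have : Subsingleton W := Fintype.card_le_one_iff_subsingleton.1 hW.le
    have := hT.connected.nonempty
    exact ⟨∅, empty_subset _, rfl, Or.inl ⟨rfl, copyOn_singleton G⟩⟩
  | succ n ih =>
    intro W _ T hT hW hdeg
    have : Nontrivial W := Fintype.one_lt_card_iff_nontrivial.1 (by omega)
    obtain ⟨l, hl⟩ := hT.exists_vert_degree_one_of_nontrivial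
    have hT' : (T.induce {l}ᶜ).IsTree :=
      ⟨hT.connected.induce_compl_singleton_of_degree_eq_one hl, hT.isAcyclic.induce _⟩
    obtain ⟨r, hr, hlr⟩ := SimpleGraph.degree_eq_one_iff_existsUnique_adj.1 hl
    obtain ⟨P, hPS, hPn, hP⟩ := ih (T.induce {l}ᶜ) hT'
      (by rw [Fintype.card_compl_set, hW]; simp) fun y hy => by have := hdeg y hy; omega
    obtain ⟨Q, hQS, hQn, hQ⟩ := hP.exists_copyOn hPS hS fun y hy => by
      have := hdeg y hy
      omega
    exact ⟨Q, hQS, by omega, Or.inr (hQ.exists_extend hr hlr)⟩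

lemma exists_copyOn [Fintype V] [Fintype W] {T : SimpleGraph W} (hT : T.IsTree)
    (G : SimpleGraph V) {S : Finset V} (hS : S.Nonempty)
    (hdeg : ∀ y ∈ S, Fintype.card W ≤ (nbrs G y ∩ S).card + 1) :
    ∃ P ⊆ S, P.card = Fintype.card W ∧ CopyOn T G P := by
  have := hT.connected.nonempty
  obtain ⟨n, hn⟩ := Nat.exists_eq_add_of_le' (Fintype.card_pos (α := W))
  obtain ⟨P, hPS, hPn, hP⟩ := exists_extendsToCopy G hS n T hT hn fun y hy => by
    have := hdeg y hy
    omega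
  obtain ⟨Q, hQS, hQn, hQ⟩ := hP.exists_copyOn hPS hS fun y hy => by
    have := hdeg y hy
    omega
  exact ⟨Q, hQS, by omega, hQ⟩

end TreeCopies

/-! ### Cographs by splitting of vertex subsets -/

section Splitting

universe v

/-- `S` splits into two non-empty parts which are completely joined or have no edges between
them. -/
def SplitsAt {V : Type v} (G : SimpleGraph V) (S : Set V) : Prop :=
  ∃ P ⊆ S, P.Nonempty ∧ (S \ P).Nonempty ∧
    ((∀ p ∈ P, ∀ q ∈ S \ P, G.Adj p q) ∨ ∀ p ∈ P, ∀ q ∈ S \ P, ¬ G.Adj p q)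

lemma SplitsAt.map {V W : Type v} {G : SimpleGraph V} {H : SimpleGraph W} (f : G ↪g H) {S : Set W}
    (hS : S ⊆ Set.range f) (hn : S.Nontrivial) (h : ∀ S : Set V, S.Nontrivial → SplitsAt G S) :
    SplitsAt H S := by
  obtain ⟨S, rfl⟩ := Set.subset_range_iff_exists_image_eq.1 hS
  have hn' : S.Nontrivial := Set.nontrivial_of_image _ _ hn
  obtain ⟨P, hPS, hP, hQ, hadj⟩ := h S hn'
  refine ⟨f '' P, Set.image_mono hPS, hP.image _, ?_, ?_⟩
  · rw [← Set.image_sdiff f.injective]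
    exact hQ.image _
  · rw [← Set.image_sdiff f.injective]
    simpa only [Set.forall_mem_image, f.map_adj_iff] using hadj

/-- A set meeting both summands splits along them; any other set lies inside one summand. -/
lemma splitsAt_of_sum_type {V W : Type v} {G : SimpleGraph V} {H : SimpleGraph W}
    {K : SimpleGraph (V ⊕ W)} (f : G ↪g K) (g : H ↪g K) (hf : ⇑f = Sum.inl) (hg : ⇑g = Sum.inr)
    (hK : (∀ v w, K.Adj (.inl v) (.inr w)) ∨ ∀ v w, ¬ K.Adj (.inl v) (.inr w))
    (hG : ∀ S : Set V, S.Nontrivial → SplitsAt G S) (hH : ∀ S : Set W, S.Nontrivial → SplitsAt H S)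
    (S : Set (V ⊕ W)) (hS : S.Nontrivial) : SplitsAt K S := by
  by_cases h1 : ∃ v, Sum.inl v ∈ S
  · by_cases h2 : ∃ w, Sum.inr w ∈ S
    · obtain ⟨v, hv⟩ := h1
      obtain ⟨w, hw⟩ := h2
      refine ⟨S ∩ Set.range Sum.inl, Set.inter_subset_left, ⟨_, hv, v, rfl⟩, ⟨_, hw, by simp⟩, ?_⟩
      have key : ∀ q ∈ S \ (S ∩ Set.range Sum.inl), ∃ w : W, q = Sum.inr w := by
        rintro (q | q) hq
        · exact absurd ⟨hq.1, q, rfl⟩ hq.2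
        · exact ⟨q, rfl⟩
      refine hK.imp ?_ ?_
      · rintro h _ ⟨-, v, rfl⟩ q hq
        obtain ⟨w, rfl⟩ := key q hq
        exact h v w
      · rintro h _ ⟨-, v, rfl⟩ q hq
        obtain ⟨w, rfl⟩ := key q hq
        exact h v w
    · refine SplitsAt.map f ?_ hS hG
      rw [hf]
      rintro (q | q) hq
      · exact ⟨q, rfl⟩
      · exact absurd ⟨q, hq⟩ h2
  · refine SplitsAt.map g ?_ hS hH
    rw [hg]
    rintro (q | q) hq
    · exact absurd ⟨q, hq⟩ h1
    · exact ⟨q, rfl⟩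

lemma IsCograph.splitsAt {V : Type v} {G : SimpleGraph V} (hG : IsCograph G) :
    ∀ S : Set V, S.Nontrivial → SplitsAt G S := by
  induction hG with
  | single => exact fun S hS => absurd Set.subsingleton_of_subsingleton hS.not_subsingleton
  | union _ _ ih1 ih2 =>
    exact splitsAt_of_sum_type SimpleGraph.Embedding.sumInl SimpleGraph.Embedding.sumInr rfl rfl
      (Or.inr (by simp)) ih1 ih2
  | join _ _ ih1 ih2 =>
    exact splitsAt_of_sum_type ⟨Function.Embedding.inl, by simp [graphJoin]⟩
      ⟨Function.Embedding.inr, by simp [graphJoin]⟩ rfl rfl (Or.inl (by simp [graphJoin])) ih1 ih2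
  | iso e _ ih =>
    exact fun S hS => SplitsAt.map e.toEmbedding (fun x _ => e.surjective x) hS ih

/-- Strong induction on the size of the induced subgraph: each splitting is a join or a disjoint
union of two smaller ones. -/
lemma IsCograph.of_splitsAt {V : Type v} [Finite V] [Nonempty V] {G : SimpleGraph V}
    (hG : ∀ S : Set V, S.Nontrivial → SplitsAt G S) : IsCograph G := by
  have key : ∀ n (S : Set V), S.ncard = n → S.Nonempty → IsCograph (G.induce S) := by
    intro n
    induction n using Nat.strong_induction_on with
    | _ n ih =>
      intro S hn hS
      rcases hS.exists_eq_singleton_or_nontrivial with ⟨a, rfl⟩ | hnt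
      · refine IsCograph.iso ⟨(Equiv.ofUnique PUnit ({a} : Set V)), ?_⟩ IsCograph.single
        intro x y
        have h1 : x = y := rfl
        simp [h1]
      · obtain ⟨P, hPS, hP, hQ, hadj⟩ := hG S hnt
        have hPc : P.ncard < n := by
          rw [← hn]
          refine Set.ncard_lt_ncard ⟨hPS, fun h => ?_⟩ (Set.toFinite S)
          obtain ⟨q, hq⟩ := hQ
          exact hq.2 (h hq.1)
        have hQc : (S \ P).ncard < n := by
          rw [← hn]
          refine Set.ncard_lt_ncard ⟨Set.sdiff_subset, fun h => ?_⟩ (Set.toFinite S)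
          obtain ⟨p, hp⟩ := hP
          exact (h (hPS hp)).2 hp
        have h1 := ih _ hPc P rfl hP
        have h2 := ih _ hQc (S \ P) rfl hQ
        classical
        let e : P ⊕ (S \ P : Set V) ≃ S := Equiv.Set.sumDiffSubset hPS
        have el : ∀ p : P, (e (.inl p) : V) = p := fun p => by simp [e]
        have er : ∀ q : (S \ P : Set V), (e (.inr q) : V) = q := fun q => by simp [e]
        rcases hadj with hadj | hadj
        · refine IsCograph.iso ⟨e, ?_⟩ (IsCograph.join h1 h2)
          rintro (a | a) (b | b)
          · simp [graphJoin, el]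
          · simp [graphJoin, el, er, hadj a a.2 b b.2]
          · simp [graphJoin, el, er, (hadj b b.2 a a.2).symm]
          · simp [graphJoin, er]
        · refine IsCograph.iso ⟨e, ?_⟩ (IsCograph.union h1 h2)
          rintro (a | a) (b | b)
          · simp [el]
          · simp [el, er, hadj a a.2 b b.2]
          · simpa [el, er] using fun h => hadj b b.2 a a.2 h.symm
          · simp [er]
  exact IsCograph.iso (SimpleGraph.induceUnivIso G) (key _ Set.univ rfl Set.univ_nonempty)

end Splitting

/-! ### Small graphs and joins with two vertices on each side -/

section Removal

open Finset
open scoped Classical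

universe v w

variable {V : Type v} {W : Type w}

/-- The vertex sets `A` and `B` cover `G` and are completely joined. -/
structure IsJoin (G : SimpleGraph V) (A B : Finset V) : Prop where
  cover : ∀ v, v ∈ A ∨ v ∈ B
  adj : ∀ a ∈ A, ∀ b ∈ B, G.Adj a b

lemma IsJoin.symm {G : SimpleGraph V} {A B : Finset V} (h : IsJoin G A B) : IsJoin G B A :=
  ⟨fun v => (h.cover v).symm, fun b hb a ha => (h.adj a ha b hb).symm⟩

lemma IsJoin.disjoint {G : SimpleGraph V} {A B : Finset V} (h : IsJoin G A B) : Disjoint A B :=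
  disjoint_left.2 fun a ha hb => (h.adj a ha a hb).ne rfl

lemma two_le_card_sdiff {A Q : Finset V} {a b : V} (hab : a ≠ b) (ha : a ∈ A) (hb : b ∈ A)
    (haQ : a ∉ Q) (hbQ : b ∉ Q) : 2 ≤ (A \ Q).card :=
  one_lt_card.2 ⟨a, mem_sdiff.2 ⟨ha, haQ⟩, b, mem_sdiff.2 ⟨hb, hbQ⟩, hab⟩

variable [Fintype V] [Fintype W]

/-- Some copy of `T` in `G` can be removed so that a super edge-connected graph is left. -/
def HasSuperRemoval (T : SimpleGraph W) (G : SimpleGraph V) : Prop :=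
  ∃ P : Finset V, CopyOn T G P ∧
    ∀ R : Set V, (∀ v, v ∈ R ↔ v ∉ P) → IsSuperEdgeConnected (G.induce R)

lemma card_nbrs_sdiff_add (G : SimpleGraph V) (x : V) (P : Finset V) :
    (nbrs G x).card ≤ (nbrs G x \ P).card + P.card := by
  have h1 := card_sdiff_add_card_inter (nbrs G x) P
  have h2 : (nbrs G x ∩ P).card ≤ P.card := card_le_card inter_subset_right
  omega

/-- Two adjacent vertices have a common neighbour by counting, which gives a triangle p, q, r to
spare. At most four vertices remain, all of degree at least two, so non-adjacent ones share a
neighbour. A bad set would have to split four vertices two against two, cutting the triangle. -/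
lemma hasSuperRemoval_of_card_le [Nonempty V] {T : SimpleGraph W} (hT : T.IsTree)
    {G : SimpleGraph V} (hdeg : ∀ v, Fintype.card W + 2 ≤ (nbrs G v).card)
    (hcard : Fintype.card V ≤ Fintype.card W + 4) : HasSuperRemoval T G := by
  have := hT.connected.nonempty
  have hW := Fintype.card_pos (α := W)
  obtain ⟨p⟩ := ‹Nonempty V›
  obtain ⟨q, hq⟩ : (nbrs G p).Nonempty := card_pos.1 (by have := hdeg p; omega)
  obtain ⟨r, hr⟩ : (nbrs G p ∩ nbrs G q).Nonempty := by
    apply card_pos.1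
    have h1 := card_union_add_card_inter (nbrs G p) (nbrs G q)
    have h2 := card_le_univ (nbrs G p ∪ nbrs G q)
    have := hdeg p
    have := hdeg q
    omega
  rw [mem_nbrs] at hq
  rw [mem_inter, mem_nbrs, mem_nbrs] at hr
  have h3 : ({p, q, r} : Finset V).card ≤ 3 := card_le_three
  have hS : (({p, q, r} : Finset V)ᶜ).Nonempty := by
    apply card_pos.1
    rw [card_compl]
    have := hdeg p
    have := card_lt_univ_of_notMem (s := nbrs G p) (x := p) (by simp)
    omega
  obtain ⟨P, hPS, hPc, hP⟩ := exists_copyOn hT G hS fun y _ => by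
    rw [← sdiff_eq_inter_compl]
    have := card_nbrs_sdiff_add G y {p, q, r}
    have := hdeg y
    omega
  have hnot : ∀ u ∈ ({p, q, r} : Finset V), u ∉ P := fun u hu h => by
    have := hPS h
    rw [mem_compl] at this
    exact this hu
  have hpP := hnot p (by simp)
  have hqP := hnot q (by simp)
  have hrP := hnot r (by simp)
  have hd : ∀ y, 2 ≤ (nbrs G y \ P).card := fun y => by
    have := card_nbrs_sdiff_add G y P
    have := hdeg y
    omega
  have hPcompl : Pᶜ.card ≤ 4 := by rw [card_compl]; omega
  refine ⟨P, hP, fun R hR => isSuperEdgeConnected_induce hR hpP ?_ ?_⟩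
  · intro x y hx hy hxy hadj
    have h1 : (nbrs G x \ P) ∪ (nbrs G y \ P) ⊆ (Pᶜ.erase x).erase y := by
      intro c hc
      simp only [mem_union, mem_sdiff, mem_nbrs] at hc
      simp only [mem_erase, mem_compl]
      rcases hc with ⟨h1, h2⟩ | ⟨h1, h2⟩
      · exact ⟨fun h => hadj (h ▸ h1), h1.ne', h2⟩
      · exact ⟨h1.ne', fun h => hadj (h ▸ h1).symm, h2⟩
    have h2 := card_le_card h1
    rw [card_erase_of_mem (by simp [hy, hxy.symm]), card_erase_of_mem (by simpa using hx)] at h2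
    have h3 := card_union_add_card_inter (nbrs G x \ P) (nbrs G y \ P)
    have := hd x
    have := hd y
    obtain ⟨c, hc⟩ : ((nbrs G x \ P) ∩ (nbrs G y \ P)).Nonempty := card_pos.1 (by omega)
    simp only [mem_inter, mem_sdiff, mem_nbrs] at hc
    exact ⟨c, hc.1.2, hc.1.1, hc.2.1.symm⟩
  · intro X hXP hX2 hXc _ _ _ hout
    have hsub : X ⊆ Pᶜ := fun x hx => mem_compl.2 (disjoint_left.1 hXP hx)
    have hsum := card_sdiff_add_card_eq_card hsub
    have uniq : ∀ x ∈ X, ∀ y y', y ∉ P → y ∉ X → y' ∉ P → y' ∉ X → G.Adj x y → G.Adj x y' →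
        y = y' := by
      intro x hx y y' h1 h2 h3 h4 h5 h6
      exact card_le_one.1 (hout x hx).le y (by simp [*]) y' (by simp [*])
    -- If X = {p, q}, the only outside neighbour of both is r, so the fourth vertex y could be
    -- adjacent to r alone.
    have two : ∀ p q r, p ∈ X → q ∈ X → p ≠ q → r ∉ X → r ∉ P → G.Adj p r → G.Adj q r → False := by
      intro p q r hp hq hpq hr hrP hpr hqr
      obtain ⟨y, hy, hyr⟩ := exists_mem_ne (by omega : 1 < (Pᶜ \ X).card) r
      rw [mem_sdiff, mem_compl] at hy
      have hX : X = {p, q} := by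
        symm
        apply eq_of_subset_of_card_le
        · intro u hu
          rw [mem_insert, mem_singleton] at hu
          rcases hu with rfl | rfl <;> assumption
        · rw [card_pair hpq]; omega
      have hc : Pᶜ \ X = {r, y} := by
        symm
        apply eq_of_subset_of_card_le
        · intro u hu
          rw [mem_insert, mem_singleton] at hu
          rw [mem_sdiff, mem_compl]
          rcases hu with rfl | rfl
          · exact ⟨hrP, hr⟩
          · exact hy
        · rw [card_pair hyr.symm]; omega
      have h1 : nbrs G y \ P ⊆ {r} := by
        intro u hu
        rw [mem_sdiff, mem_nbrs] at hu
        rw [mem_singleton]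
        by_cases huX : u ∈ X
        · rw [hX, mem_insert, mem_singleton] at huX
          rcases huX with rfl | rfl
          · exact absurd (uniq _ hp y r hy.1 hy.2 hrP hr hu.1.symm hpr) hyr
          · exact absurd (uniq _ hq y r hy.1 hy.2 hrP hr hu.1.symm hqr) hyr
        · have : u ∈ Pᶜ \ X := by simp [hu.2, huX]
          rw [hc, mem_insert, mem_singleton] at this
          exact this.resolve_right hu.1.ne'
      have h2 := card_le_card h1
      have h3 := hd y
      rw [card_singleton] at h2
      omega
    have three : ∀ Y : Finset V, p ∈ Y → q ∈ Y → r ∈ Y → 3 ≤ Y.card := by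
      intro Y h1 h2 h3
      have : ({p, q, r} : Finset V) ⊆ Y := by
        intro u hu
        simp only [mem_insert, mem_singleton] at hu
        rcases hu with rfl | rfl | rfl <;> assumption
      rw [← card_eq_three.2 ⟨p, q, r, hq.ne, hr.1.ne, hr.2.ne, rfl⟩]
      exact card_le_card this
    by_cases hp : p ∈ X <;> by_cases hq' : q ∈ X <;> by_cases hr' : r ∈ X
    · have := three X hp hq' hr'
      omega
    · exact two p q r hp hq' hq.ne hr' hrP hr.1 hr.2
    · exact two p r q hp hr' hr.1.ne hq' hqP hq hr.2.symm
    · exact hr.2.ne (uniq p hp q r hqP hq' hrP hr' hq hr.1)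
    · exact two q r p hq' hr' hr.2.ne hp hpP hq.symm hr.1.symm
    · exact hr.1.ne (uniq q hq' p r hpP hp hrP hr' hq.symm hr.2)
    · exact hq.ne (uniq r hr' p q hpP hp hqP hq' hr.1.symm hr.2.symm)
    · have := three (Pᶜ \ X) (by simp [*]) (by simp [*]) (by simp [*])
      omega

/-- A vertex of a bad set X sees the whole opposite side, so at most one vertex there avoids X.
Hence X meets both sides and misses exactly one vertex of each. -/
lemma IsJoin.isSuperEdgeConnected_induce {G : SimpleGraph V} {A B P : Finset V}
    (h : IsJoin G A B) (hA : 2 ≤ (A \ P).card) (hB : 2 ≤ (B \ P).card) (hP : 5 ≤ Pᶜ.card)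
    {R : Set V} (hR : ∀ v, v ∈ R ↔ v ∉ P) : IsSuperEdgeConnected (G.induce R) := by
  obtain ⟨a, ha⟩ := card_pos.1 (by omega : 0 < (A \ P).card)
  obtain ⟨b, hb⟩ := card_pos.1 (by omega : 0 < (B \ P).card)
  rw [mem_sdiff] at ha hb
  refine _root_.isSuperEdgeConnected_induce hR ha.2 ?_ ?_
  · intro x y _ _ _ hadj
    rcases h.cover x with hx | hx <;> rcases h.cover y with hy | hy
    · exact ⟨b, hb.2, h.adj x hx b hb.1, (h.adj y hy b hb.1).symm⟩
    · exact absurd (h.adj x hx y hy) hadj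
    · exact absurd (h.adj y hy x hx).symm hadj
    · exact ⟨a, ha.2, (h.adj a ha.1 x hx).symm, h.adj a ha.1 y hy⟩
  · intro X hXP hX2 hXc hmin _ _ hout
    have side : ∀ {A B : Finset V}, IsJoin G A B → ∀ x ∈ X, x ∈ A → ((B \ P) \ X).card ≤ 1 := by
      intro A B h x hx hxA
      rw [← hout x hx]
      refine card_le_card fun y hy => ?_
      simp only [mem_sdiff, mem_nbrs] at hy ⊢
      exact ⟨⟨h.adj x hxA y hy.1.1, hy.1.2⟩, hy.2⟩
    have meet : ∀ {B : Finset V}, 2 ≤ (B \ P).card → ((B \ P) \ X).card ≤ 1 →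
        ∃ y ∈ X, y ∈ B := by
      intro B h1 h2
      by_contra! hc
      have heq : (B \ P) \ X = (B \ P) := sdiff_eq_self_of_disjoint
        (disjoint_left.2 fun y hy hyX => hc y hyX (mem_sdiff.1 hy).1)
      rw [heq] at h2
      omega
    obtain ⟨x, hx⟩ := card_pos.1 (by omega : 0 < X.card)
    have hboth : (∃ y ∈ X, y ∈ A) ∧ ∃ y ∈ X, y ∈ B := by
      rcases h.cover x with hxA | hxB
      · exact ⟨⟨x, hx, hxA⟩, meet hB (side h x hx hxA)⟩
      · exact ⟨meet hA (side h.symm x hx hxB), ⟨x, hx, hxB⟩⟩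
    obtain ⟨⟨xa, hxa, hxaA⟩, ⟨xb, hxb, hxbB⟩⟩ := hboth
    have hB1 := side h xa hxa hxaA
    have hA1 := side h.symm xb hxb hxbB
    have hcov : Pᶜ \ X ⊆ ((A \ P) \ X) ∪ ((B \ P) \ X) := by
      intro y hy
      simp only [mem_union, mem_sdiff, mem_compl] at hy ⊢
      rcases h.cover y with h1 | h1
      · exact Or.inl ⟨⟨h1, hy.1⟩, hy.2⟩
      · exact Or.inr ⟨⟨h1, hy.1⟩, hy.2⟩
    have h2 := (card_le_card hcov).trans (card_union_le _ _)
    -- The missed vertices a and b are adjacent. A vertex of X in A already has b as its outside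
    -- neighbour, so it is not adjacent to a; then a has at most 1 + |X ∩ B| neighbours, but needs
    -- |X|.
    have part : ∀ {A B : Finset V}, IsJoin G A B → ((A \ P) \ X).card = 1 →
        ((B \ P) \ X).card = 1 → (X ∩ A).card ≤ 1 := by
      intro A B h hA hB
      obtain ⟨a, ha⟩ := card_eq_one.1 hA
      obtain ⟨b, hb⟩ := card_eq_one.1 hB
      have ha' : a ∈ (A \ P) \ X := by rw [ha]; exact mem_singleton_self a
      have hb' : b ∈ (B \ P) \ X := by rw [hb]; exact mem_singleton_self b
      simp only [mem_sdiff] at ha' hb'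
      have hsub : nbrs G a \ P ⊆ insert b (X ∩ B) := by
        intro y hy
        simp only [mem_sdiff, mem_nbrs, mem_insert, mem_inter] at hy ⊢
        by_cases hyX : y ∈ X
        · rcases h.cover y with hyA | hyB
          · have := card_le_one.1 (hout y hyX).le a (by simp [ha', hy.1.symm]) b
              (by simp [hb', h.adj y hyA b hb'.1.1])
            exact absurd (this ▸ h.adj a ha'.1.1 b hb'.1.1) (G.irrefl)
          · exact Or.inr ⟨hyX, hyB⟩
        · left
          rcases h.cover y with hyA | hyB
          · have : y ∈ (A \ P) \ X := by simp [hyA, hy.2, hyX]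
            rw [ha, mem_singleton] at this
            exact absurd (this ▸ hy.1) (G.irrefl)
          · have : y ∈ (B \ P) \ X := by simp [hyB, hy.2, hyX]
            rwa [hb, mem_singleton] at this
      have h3 := (card_le_card hsub).trans (card_insert_le _ _)
      have h4 := hmin a ha'.1.2
      have h5 : (X ∩ A).card + (X ∩ B).card ≤ X.card := by
        rw [← card_union_of_disjoint]
        · exact card_le_card (union_subset inter_subset_left inter_subset_left)
        · exact h.disjoint.mono inter_subset_right inter_subset_right
      omega
    have h3 := part h (by omega) (by omega)
    have h4 := part h.symm (by omega) (by omega)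
    have h5 : X ⊆ (X ∩ A) ∪ (X ∩ B) := by
      intro y hy
      rw [← inter_union_distrib_left, mem_inter, mem_union]
      exact ⟨hy, h.cover y⟩
    have h6 := (card_le_card h5).trans (card_union_le _ _)
    have hsub : X ⊆ Pᶜ := fun x hx => mem_compl.2 (disjoint_left.1 hXP hx)
    have hsum := card_sdiff_add_card_eq_card hsub
    have h7 := card_le_card hcov
    omega

/-- If all neighbours of `s` lie in `P ∪ S`, then `s` is adjacent to all of `S` by counting. -/
lemma adj_of_card_le {G : SimpleGraph V} {K P S : Finset V} {s : V} (hs : s ∈ P)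
    (hsub : nbrs G s ∩ K ⊆ P ∪ S) (hcard : P.card + S.card ≤ (nbrs G s ∩ K).card + 1) :
    ∀ y ∈ S, G.Adj s y := by
  have h1 : nbrs G s ∩ K ⊆ (P.erase s) ∪ S.erase s := by
    rw [← erase_union_distrib]
    exact subset_erase.2 ⟨hsub, by simp⟩
  have h2 := card_union_le (P.erase s) (S.erase s)
  have h3 := card_erase_of_mem hs
  have hpos := card_pos.2 ⟨s, hs⟩
  have h4 := card_le_card h1
  intro y hy
  have hsS : s ∉ S := by
    intro h
    have := card_erase_lt_of_mem h
    omega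
  rw [erase_eq_of_notMem hsS] at h1 h2
  have h6 := eq_of_subset_of_card_le h1 (by omega)
  have : y ∈ nbrs G s ∩ K := by
    rw [h6]
    exact mem_union_right _ hy
  exact mem_nbrs.1 (mem_inter.1 this).1

lemma IsJoin.hasSuperRemoval {T : SimpleGraph W} (hT : T.IsTree) {G : SimpleGraph V}
    {A B : Finset V} (h : IsJoin G A B) (hA : 2 ≤ A.card) (hB : 2 ≤ B.card)
    (hdeg : ∀ v, Fintype.card W + 2 ≤ (nbrs G v).card)
    (hcard : Fintype.card W + 5 ≤ Fintype.card V) : HasSuperRemoval T G := by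
  have := hT.connected.nonempty
  obtain ⟨n, hn⟩ := Nat.exists_eq_add_of_le' (Fintype.card_pos (α := W))
  suffices hQ : ∃ Q : Finset V, Q.card = n + 1 ∧ CopyOn T G Q ∧ 2 ≤ (A \ Q).card ∧
      2 ≤ (B \ Q).card by
    obtain ⟨Q, hQc, hQ, h1, h2⟩ := hQ
    exact ⟨Q, hQ, fun R hR => h.isSuperEdgeConnected_induce h1 h2 (by rw [card_compl]; omega) hR⟩
  obtain ⟨a, ha, a', ha', haa⟩ := one_lt_card.1 hA
  obtain ⟨b, hb, b', hb', hbb⟩ := one_lt_card.1 hB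
  have h4 : ({a, a', b, b'} : Finset V).card ≤ 4 := card_le_four
  obtain ⟨S, hS⟩ : ∃ S : Finset V, S = {a, a', b, b'}ᶜ := ⟨_, rfl⟩
  have hSc : Fintype.card V ≤ S.card + 4 := by rw [hS, card_compl]; omega
  obtain ⟨P, hPS, hPn, hP⟩ := exists_extendsToCopy G (S := S) (card_pos.1 (by omega)) n T hT hn
    fun y _ => by
      rw [hS, ← sdiff_eq_inter_compl]
      have := card_nbrs_sdiff_add G y {a, a', b, b'}
      have := hdeg y
      omega
  have hSmem : ∀ y, y ∈ S ↔ y ≠ a ∧ y ≠ a' ∧ y ≠ b ∧ y ≠ b' := by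
    intro y
    rw [hS]
    simp only [mem_compl, mem_insert, mem_singleton, not_or]
  have fin : ∀ y ∈ S, y ∉ P → CopyOn T G (insert y P) → ∃ Q : Finset V, Q.card = n + 1 ∧
      CopyOn T G Q ∧ 2 ≤ (A \ Q).card ∧ 2 ≤ (B \ Q).card := by
    intro y hyS hyP hy
    have hn : ∀ u, u ∉ S → u ∉ insert y P := fun u hu hm => hu (by
      rcases mem_insert.1 hm with rfl | hm
      · exact hyS
      · exact hPS hm)
    refine ⟨insert y P, by rw [card_insert_of_notMem hyP, hPn], hy,
      two_le_card_sdiff haa ha ha' (hn _ ?_) (hn _ ?_),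
      two_le_card_sdiff hbb hb hb' (hn _ ?_) (hn _ ?_)⟩ <;> simp [hSmem]
  obtain ⟨u, hu⟩ : (S \ P).Nonempty := by
    apply card_pos.1
    have := le_card_sdiff P S
    omega
  rw [mem_sdiff] at hu
  rcases hP with ⟨rfl, hP⟩ | ⟨s, hs, hP⟩
  · exact fin u hu.1 hu.2 (by simpa using hP u)
  by_cases hy : ∃ y ∈ S \ P, G.Adj s y
  · obtain ⟨y, hy, hsy⟩ := hy
    rw [mem_sdiff] at hy
    exact fin y hy.1 hy.2 (hP y hy.2 hsy)
  push Not at hy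
  -- The count is tight: s has at least n + 3 neighbours, and only n - 1 vertices of P and 4 spared
  -- ones are available.
  have hadj := adj_of_card_le (G := G) (K := univ) (S := Sᶜ) hs (by
    intro y hyn
    rw [mem_inter, mem_nbrs] at hyn
    rw [mem_union, mem_compl]
    by_contra! hc
    exact hy y (mem_sdiff.2 ⟨hc.2, hc.1⟩) hyn.1) (by
      rw [inter_univ, card_compl]
      have := hdeg s
      have := card_le_univ S
      omega)
  have hsu : ¬ G.Adj s u := hy u (mem_sdiff.2 hu)
  have hu4 := (hSmem u).1 hu.1
  have hnP : ∀ y, y ∉ S → y ∉ P := fun y hy hyP => hy (hPS hyP)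
  have haP : a ∉ P := hnP a (by simp [hSmem])
  have haP' : a' ∉ P := hnP a' (by simp [hSmem])
  have hbP : b ∉ P := hnP b (by simp [hSmem])
  have hbP' : b' ∉ P := hnP b' (by simp [hSmem])
  have hab := fun x hx y hy => (h.adj x hx y hy).ne
  -- The leaf takes a spared vertex on the side of the unused vertex u, which replaces it there.
  rcases h.cover u with huA | huB
  · refine ⟨insert a P, by rw [card_insert_of_notMem haP, hPn],
      hP a haP (hadj a (by simp [hSmem])), two_le_card_sdiff hu4.2.1 huA ha' ?_ ?_,
      two_le_card_sdiff hbb hb hb' ?_ ?_⟩ <;> rw [mem_insert, not_or]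
    · exact ⟨hu4.1, hu.2⟩
    · exact ⟨haa.symm, haP'⟩
    · exact ⟨(hab a ha b hb).symm, hbP⟩
    · exact ⟨(hab a ha b' hb').symm, hbP'⟩
  · refine ⟨insert b P, by rw [card_insert_of_notMem hbP, hPn],
      hP b hbP (hadj b (by simp [hSmem])), two_le_card_sdiff haa ha ha' ?_ ?_,
      two_le_card_sdiff hu4.2.2.2 huB hb' ?_ ?_⟩ <;> rw [mem_insert, not_or]
    · exact ⟨hab a ha b hb, haP⟩
    · exact ⟨hab a' ha' b hb, haP'⟩
    · exact ⟨hu4.2.2.1, hu.2⟩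
    · exact ⟨hbb.symm, hbP'⟩

end Removal

/-! ### Universal vertices and the general case -/

section Cone

open Finset
open scoped Classical

universe v w

variable {V : Type v} {W : Type w} [Fintype V] [Fintype W]

/-- `R` is connected and not complete, as witnessed by an induced path `p - x - q` which
dominates `R` suitably. -/
def HasWitness (G : SimpleGraph V) (R : Finset V) : Prop :=
  ∃ p ∈ R, ∃ q ∈ R, ∃ x ∈ R, p ≠ q ∧ ¬ G.Adj p q ∧ G.Adj x p ∧ G.Adj x q ∧
    ∀ y ∈ R, y = p ∨ y = q ∨ G.Adj y p ∨ G.Adj y x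

/-- A copy of `T` can be removed from a joined set `C ∪ D` which is not complete, such that the
rest is connected, not complete, and has a vertex of degree at most `k`. -/
lemma exists_copyOn_hasWitness {T : SimpleGraph W} (hT : T.IsTree) {G : SimpleGraph V}
    {K C D : Finset V} (hK : ∀ y, y ∈ K ↔ y ∈ C ∨ y ∈ D) (hCD : ∀ c ∈ C, ∀ d ∈ D, G.Adj c d)
    {v w x : V} (hv : v ∈ C) (hw : w ∈ C) (hx : x ∈ D) (hvw : v ≠ w) (hnvw : ¬ G.Adj v w)
    {k : ℕ} (hvk : (nbrs G v ∩ K).card = k) (hdeg : ∀ y ∈ K, k ≤ (nbrs G y ∩ K).card)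
    (hk : Fintype.card W + 1 ≤ k) (hKc : Fintype.card W + 3 ≤ K.card) :
    ∃ Q ⊆ K, CopyOn T G Q ∧ HasWitness G (K \ Q) ∧
      ∃ r ∈ K \ Q, ((nbrs G r ∩ K) \ Q).card ≤ k := by
  have := hT.connected.nonempty
  obtain ⟨n, hn⟩ := Nat.exists_eq_add_of_le' (Fintype.card_pos (α := W))
  have hCK : ∀ y ∈ C, y ∈ K := fun y hy => (hK y).2 (Or.inl hy)
  have hDK : ∀ y ∈ D, y ∈ K := fun y hy => (hK y).2 (Or.inr hy)
  have hCDn : ∀ c ∈ C, ∀ d ∈ D, c ≠ d := fun c hc d hd => (hCD c hc d hd).ne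
  -- the conclusion when `p, q ∈ C` and `d ∈ D` are left
  have wit : ∀ Q : Finset V, ∀ p q d, p ∈ C → q ∈ C → d ∈ D → p ∉ Q → q ∉ Q → d ∉ Q → p ≠ q →
      ¬ G.Adj p q → HasWitness G (K \ Q) := by
    intro Q p q d hp hq hd hpQ hqQ hdQ hpq hadj
    refine ⟨p, mem_sdiff.2 ⟨hCK p hp, hpQ⟩, q, mem_sdiff.2 ⟨hCK q hq, hqQ⟩, d,
      mem_sdiff.2 ⟨hDK d hd, hdQ⟩, hpq, hadj, (hCD p hp d hd).symm, (hCD q hq d hd).symm, ?_⟩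
    intro y hy
    rcases (hK y).1 (mem_sdiff.1 hy).1 with h | h
    · exact Or.inr (Or.inr (Or.inr (hCD y h d hd)))
    · exact Or.inr (Or.inr (Or.inl (hCD p hp y h).symm))
  have low : ∀ Q : Finset V, v ∉ Q → ∃ r ∈ K \ Q, ((nbrs G r ∩ K) \ Q).card ≤ k :=
    fun Q hQ => ⟨v, mem_sdiff.2 ⟨hCK v hv, hQ⟩, (card_le_card sdiff_subset).trans hvk.le⟩
  have h3 : ({v, w, x} : Finset V).card ≤ 3 := card_le_three
  have hvwxK : {v, w, x} ⊆ K := by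
    intro y hy
    simp only [mem_insert, mem_singleton] at hy
    rcases hy with rfl | rfl | rfl
    · exact hCK _ hv
    · exact hCK _ hw
    · exact hDK _ hx
  obtain ⟨S, hS⟩ : ∃ S : Finset V, S = K \ {v, w, x} := ⟨_, rfl⟩
  have hSc : K.card ≤ S.card + 3 := by
    rw [hS]
    have := card_sdiff_add_card_eq_card hvwxK
    omega
  have hSmem : ∀ y, y ∈ S ↔ y ∈ K ∧ y ≠ v ∧ y ≠ w ∧ y ≠ x := by
    intro y
    rw [hS]
    simp only [mem_sdiff, mem_insert, mem_singleton, not_or]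
  obtain ⟨P, hPS, hPn, hP⟩ := exists_extendsToCopy G (S := S) (card_pos.1 (by omega)) n T hT hn
    fun y hy => by
      have h1 : nbrs G y ∩ S = (nbrs G y ∩ K) \ {v, w, x} := by rw [hS, inter_sdiff_assoc]
      have h2 := le_card_sdiff ({v, w, x} : Finset V) (nbrs G y ∩ K)
      have := hdeg y ((hSmem y).1 hy).1
      rw [h1]
      omega
  have hPK : ∀ y ∈ P, y ∈ K := fun y hy => ((hSmem y).1 (hPS hy)).1
  have hvP : v ∉ P := fun h => ((hSmem v).1 (hPS h)).2.1 rfl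
  have hwP : w ∉ P := fun h => ((hSmem w).1 (hPS h)).2.2.1 rfl
  have hxP : x ∉ P := fun h => ((hSmem x).1 (hPS h)).2.2.2 rfl
  have sub : ∀ y ∈ K, insert y P ⊆ K := fun y hy => insert_subset hy hPK
  have nmem : ∀ {a y : V}, a ≠ y → a ∉ P → a ∉ insert y P := fun h1 h2 h3 =>
    (mem_insert.1 h3).elim h1 h2
  have fin : ∀ y ∈ S, CopyOn T G (insert y P) → ∃ Q ⊆ K, CopyOn T G Q ∧
      HasWitness G (K \ Q) ∧ ∃ r ∈ K \ Q, ((nbrs G r ∩ K) \ Q).card ≤ k := by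
    intro y hyS hy
    obtain ⟨hyK, hyv, hyw, hyx⟩ := (hSmem y).1 hyS
    exact ⟨insert y P, sub y hyK, hy, wit _ v w x hv hw hx (nmem hyv.symm hvP) (nmem hyw.symm hwP)
      (nmem hyx.symm hxP) hvw hnvw, low _ (nmem hyv.symm hvP)⟩
  obtain ⟨u₀, hu₀⟩ : (S \ P).Nonempty := by
    apply card_pos.1
    have := le_card_sdiff P S
    omega
  rcases hP with ⟨rfl, hP⟩ | ⟨s, hs, hP⟩
  · exact fin u₀ (mem_sdiff.1 hu₀).1 (by simpa using hP u₀)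
  by_cases hy : ∃ y ∈ S \ P, G.Adj s y
  · obtain ⟨y, hy, hsy⟩ := hy
    rw [mem_sdiff] at hy
    exact fin y hy.1 (hP y hy.2 hsy)
  push Not at hy
  have hsK := hPK s hs
  -- Tight again: at least n + 2 neighbours in K, against n - 1 vertices of P and the three spared
  -- ones.
  have hadj := adj_of_card_le (G := G) (K := K) (S := {v, w, x}) hs (by
    intro y hyn
    rw [mem_inter, mem_nbrs] at hyn
    by_contra hc
    rw [mem_union, not_or] at hc
    exact hy y (mem_sdiff.2 ⟨hS ▸ mem_sdiff.2 ⟨hyn.2, hc.2⟩, hc.1⟩) hyn.1) (by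
      have := hdeg s hsK
      omega)
  have hsv := hadj v (by simp)
  have hsw := hadj w (by simp)
  have hsx := hadj x (by simp)
  have hUmem : ∀ u ∈ S \ P, u ∈ K ∧ u ≠ v ∧ u ≠ w ∧ u ≠ x ∧ u ∉ P := fun u hu => by
    rw [mem_sdiff, hSmem] at hu
    exact ⟨hu.1.1, hu.1.2.1, hu.1.2.2.1, hu.1.2.2.2, hu.2⟩
  have hvx := hCDn v hv x hx
  have hwx := hCDn w hw x hx
  by_cases hUD : ∃ u ∈ S \ P, u ∈ D
  · obtain ⟨u, hu, huD⟩ := hUD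
    obtain ⟨-, -, -, hux, huP⟩ := hUmem u hu
    exact ⟨insert x P, sub x (hDK x hx), hP x hxP hsx, wit _ v w u hv hw huD (nmem hvx hvP)
      (nmem hwx hwP) (nmem hux huP) hvw hnvw, low _ (nmem hvx hvP)⟩
  push Not at hUD
  have hUC : ∀ u ∈ S \ P, u ∈ C := fun u hu => ((hK u).1 (hUmem u hu).1).resolve_right (hUD u hu)
  by_cases hUv : ∃ u ∈ S \ P, ¬ G.Adj v u
  · obtain ⟨u, hu, huv⟩ := hUv
    obtain ⟨-, huv', huw, -, huP⟩ := hUmem u hu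
    exact ⟨insert w P, sub w (hCK w hw), hP w hwP hsw, wit _ v u x hv (hUC u hu) hx (nmem hvw hvP)
      (nmem huw huP) (nmem hwx.symm hxP) huv'.symm huv, low _ (nmem hvw hvP)⟩
  push Not at hUv
  by_cases hUw : ∃ u ∈ S \ P, ¬ G.Adj w u
  · obtain ⟨u, hu, huw⟩ := hUw
    obtain ⟨-, huv, huw', -, huP⟩ := hUmem u hu
    refine ⟨insert v P, sub v (hCK v hv), hP v hvP hsv, wit _ w u x hw (hUC u hu) hx
      (nmem hvw.symm hwP) (nmem huv huP) (nmem hvx.symm hxP) huw'.symm huw, w,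
      mem_sdiff.2 ⟨hCK w hw, nmem hvw.symm hwP⟩, ?_⟩
    -- Here v is used up, so w becomes the vertex of small degree. All of S \ P is adjacent to v,
    -- hence has at most k elements; w misses u and gains at most x.
    have h1 : (nbrs G w ∩ K) \ insert v P ⊆ insert x ((S \ P).erase u) := by
      intro y hy
      simp only [mem_sdiff, mem_inter, mem_nbrs, mem_insert, not_or] at hy
      rw [mem_insert]
      by_cases hyx : y = x
      · exact Or.inl hyx
      · refine Or.inr (mem_erase.2 ⟨fun h => huw (h ▸ hy.1.1), ?_⟩)
        rw [mem_sdiff, hSmem]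
        exact ⟨⟨hy.1.2, hy.2.1, hy.1.1.ne', hyx⟩, hy.2.2⟩
    have h2 : S \ P ⊆ nbrs G v ∩ K := fun y hy =>
      mem_inter.2 ⟨mem_nbrs.2 (hUv y hy), (hUmem y hy).1⟩
    have h3 := (card_le_card h1).trans (card_insert_le _ _)
    have h4 := card_le_card h2
    have h5 := card_erase_lt_of_mem hu
    omega
  · push Not at hUw
    have hu₀' := hUmem u₀ hu₀
    -- All unused vertices are adjacent to both v and w, so u₀ can replace x as the middle of the
    -- path.
    refine ⟨insert x P, sub x (hDK x hx), hP x hxP hsx, ⟨v,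
      mem_sdiff.2 ⟨hCK v hv, nmem hvx hvP⟩, w, mem_sdiff.2 ⟨hCK w hw, nmem hwx hwP⟩, u₀,
      mem_sdiff.2 ⟨hu₀'.1, nmem hu₀'.2.2.2.1 hu₀'.2.2.2.2⟩, hvw, hnvw, (hUv u₀ hu₀).symm,
      (hUw u₀ hu₀).symm, fun y hy => ?_⟩, low _ (nmem hvx hvP)⟩
    rw [mem_sdiff, mem_insert, not_or] at hy
    by_cases hyv : y = v
    · exact Or.inl hyv
    by_cases hyw : y = w
    · exact Or.inr (Or.inl hyw)
    refine Or.inr (Or.inr (Or.inl (hUv y ?_).symm))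
    rw [mem_sdiff, hSmem]
    exact ⟨⟨hy.1, hyv, hyw, hy.2.1⟩, hy.2.2⟩

/-- The case of a universal vertex `z`, where `P₀` is a union of components of the rest. -/
lemma hasSuperRemoval_of_cone {T : SimpleGraph W} (hT : T.IsTree) {G : SimpleGraph V}
    (hsplit : ∀ S : Set V, S.Nontrivial → SplitsAt G S) (hsuper : IsSuperEdgeConnected G)
    (hdeg : ∀ v, Fintype.card W + 2 ≤ (nbrs G v).card) {z : V} (hz : ∀ v, v ≠ z → G.Adj z v)
    {P₀ : Finset V} (hzP : z ∉ P₀) (hP₀ : ∀ x ∈ P₀, ∀ y, y ≠ z → G.Adj x y → y ∈ P₀)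
    {p₀ q₀ : V} (hp₀ : p₀ ∈ P₀) (hq₀ : q₀ ∉ P₀) (hqz : q₀ ≠ z) : HasSuperRemoval T G := by
  have := hT.connected.nonempty
  have hW := Fintype.card_pos (α := W)
  obtain ⟨v, -, hv⟩ := exists_min_image univ (fun u => (nbrs G u).card) ⟨z, mem_univ z⟩
  replace hv : ∀ u, (nbrs G v).card ≤ (nbrs G u).card := fun u => hv u (mem_univ u)
  have hpz : p₀ ≠ z := fun h => hzP (h ▸ hp₀)
  -- The neighbourhood of p₀ misses q₀, so p₀ has smaller degree than the universal vertex z.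
  have hvz : v ≠ z := by
    rintro rfl
    have h1 : nbrs G p₀ ⊆ (nbrs G v).erase q₀ ∪ {v} := by
      intro y hy
      rw [mem_nbrs] at hy
      rw [mem_union, mem_singleton, mem_erase, mem_nbrs]
      by_cases hyv : y = v
      · exact Or.inr hyv
      · exact Or.inl ⟨fun h => hq₀ (h ▸ hP₀ p₀ hp₀ y hyv hy), hz y hyv⟩
    have h2 : nbrs G p₀ ⊆ (((nbrs G v).erase q₀).erase p₀) ∪ {v} := by
      intro y hy
      have := h1 hy
      rw [mem_union] at this ⊢
      exact this.imp_left fun h => mem_erase.2 ⟨(mem_nbrs.1 hy).ne', h⟩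
    have h3 := (card_le_card h2).trans (card_union_le _ _)
    have hq : q₀ ∈ nbrs G v := mem_nbrs.2 (hz q₀ hqz)
    have hp : p₀ ∈ (nbrs G v).erase q₀ := by
      rw [mem_erase, mem_nbrs]
      exact ⟨fun h => hq₀ (h ▸ hp₀), hz p₀ hpz⟩
    have h4 := card_erase_lt_of_mem hq
    have h5 := card_erase_lt_of_mem hp
    have := hv p₀
    rw [card_singleton] at h3
    omega
  -- the component `K` of `v` in `G - z`
  obtain ⟨K, ⟨hvK, hzK, hKcl⟩, hKmin⟩ : ∃ K : Finset V,
      (v ∈ K ∧ z ∉ K ∧ ∀ x ∈ K, ∀ y, y ≠ z → G.Adj x y → y ∈ K) ∧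
      ∀ L : Finset V, (v ∈ L ∧ z ∉ L ∧ ∀ x ∈ L, ∀ y, y ≠ z → G.Adj x y → y ∈ L) →
        K.card ≤ L.card := by
    obtain ⟨K, hK, hmin⟩ := exists_min_image (univ.filter fun K : Finset V =>
      v ∈ K ∧ z ∉ K ∧ ∀ x ∈ K, ∀ y, y ≠ z → G.Adj x y → y ∈ K) Finset.card
      ⟨univ.erase z, by simpa [hvz] using fun _ _ _ h _ => h⟩
    exact ⟨K, by simpa using hK, fun L hL => hmin L (by simpa using hL)⟩
  obtain ⟨w₀, hw₀K, hw₀z⟩ : ∃ w₀, w₀ ∉ K ∧ w₀ ≠ z := by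
    by_contra! hc
    have hall : univ.erase z ⊆ K := fun y hy => by
      by_contra h
      exact (mem_erase.1 hy).1 (hc y h)
    have hKc := card_le_card hall
    by_cases hvP : v ∈ P₀
    · have h1 := hKmin P₀ ⟨hvP, hzP, hP₀⟩
      have h2 : P₀ ⊂ univ.erase z := by
        refine (ssubset_iff_of_subset fun y hy => ?_).2 ⟨q₀, by simp [hqz], hq₀⟩
        exact mem_erase.2 ⟨fun h => hzP (h ▸ hy), mem_univ y⟩
      have := card_lt_card h2
      omega
    · have h1 := hKmin ((univ.erase z) \ P₀) ⟨by simp [hvz, hvP], by simp, fun x hx y hyz hxy => by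
        simp only [mem_sdiff, mem_erase, mem_univ, and_true] at hx ⊢
        exact ⟨hyz, fun h => hx.2 (hP₀ y h x hx.1 hxy.symm)⟩⟩
      have h2 : (univ.erase z) \ P₀ ⊂ univ.erase z := by
        refine (ssubset_iff_of_subset sdiff_subset).2 ⟨p₀, by simp [hpz], ?_⟩
        simp [hp₀]
      have := card_lt_card h2
      omega
  have hKn : ∀ y ∈ K, (nbrs G y).card = (nbrs G y ∩ K).card + 1 := by
    intro y hy
    have : nbrs G y = insert z (nbrs G y ∩ K) := by
      ext c
      rw [mem_insert, mem_inter, mem_nbrs]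
      constructor
      · intro h
        by_cases hcz : c = z
        · exact Or.inl hcz
        · exact Or.inr ⟨h, hKcl y hy c hcz h⟩
      · rintro (rfl | h)
        · exact (hz y fun h => hzK (h ▸ hy)).symm
        · exact h.1
    have h2 := congrArg Finset.card this
    rwa [card_insert_of_notMem (by simp [hzK])] at h2
  have hvd := hdeg v
  have hvK' := hKn v hvK
  have hKlt : (nbrs G v ∩ K).card < K.card := by
    refine card_lt_card ((ssubset_iff_of_subset inter_subset_right).2 ⟨v, hvK, by simp⟩)
  -- a closed set with as many vertices as the minimum degree is impossible
  have hnoX : ∀ X : Finset V, ∀ b, z ∉ X → (∀ x ∈ X, ∀ y, y ≠ z → G.Adj x y → y ∈ X) → b ∉ X →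
      b ≠ z → X.card ≠ (nbrs G v).card := by
    intro X b hzX hX hb hbz hc
    refine not_isSuperEdgeConnected_of_universal hz hzX (fun x hx y hxy => ?_) hb hbz (by omega)
      (fun u => hc ▸ hv u) hsuper
    by_cases hyz : y = z
    · exact Or.inr hyz
    · exact Or.inl (hX x hx y hyz hxy)
  have hKne := hnoX K w₀ hzK hKcl hw₀K hw₀z
  -- If v were adjacent to all of K, then K would have exactly δ vertices, which `hKne` forbids.
  obtain ⟨w, hwK, hwv, hnvw⟩ : ∃ w ∈ K, w ≠ v ∧ ¬ G.Adj v w := by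
    by_contra! hc
    have h1 : K.erase v ⊆ nbrs G v ∩ K := fun y hy => by
      rw [mem_erase] at hy
      exact mem_inter.2 ⟨mem_nbrs.2 (hc y hy.2 hy.1), hy.2⟩
    have h2 := card_le_card h1
    rw [card_erase_of_mem hvK] at h2
    omega
  -- By minimality K is connected, so it can only split as a join.
  obtain ⟨C, D, hKCD, hCD, hvC, hD⟩ : ∃ C D : Finset V, (∀ y, y ∈ K ↔ y ∈ C ∨ y ∈ D) ∧
      (∀ c ∈ C, ∀ d ∈ D, G.Adj c d) ∧ v ∈ C ∧ D.Nonempty := by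
    obtain ⟨P, hPK, ⟨a, ha⟩, ⟨b, hb⟩, hPQ⟩ := hsplit K ⟨v, hvK, w, hwK, hwv.symm⟩
    have hfull : ∀ L : Set V, v ∈ L → L ⊆ K → (∀ x ∈ L, ∀ y, y ∈ K → G.Adj x y → y ∈ L) →
        ∀ y ∈ K, y ∈ L := by
      intro L hvL hLK hL
      have h1 := hKmin (K.filter (· ∈ L)) ⟨by simp [hvK, hvL], by simp [hzK], fun x hx y hyz hxy => by
        rw [mem_filter] at hx ⊢
        have := hKcl x hx.1 y hyz hxy
        exact ⟨this, hL x hx.2 y this hxy⟩⟩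
      have h2 := eq_of_subset_of_card_le (filter_subset (· ∈ L) K) h1
      exact filter_eq_self.1 h2
    have hmem : ∀ y, y ∈ K ↔ y ∈ K.filter (· ∈ P) ∨ y ∈ K.filter (· ∉ P) := by
      intro y
      simp only [mem_filter]
      tauto
    have hbK : b ∈ K := hb.1
    rcases hPQ with hPQ | hPQ
    · have hadj : ∀ c ∈ K.filter (· ∈ P), ∀ d ∈ K.filter (· ∉ P), G.Adj c d := fun c hc d hd => by
        rw [mem_filter] at hc hd
        exact hPQ c hc.2 d ⟨hd.1, hd.2⟩
      by_cases hvP : v ∈ P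
      · exact ⟨_, _, hmem, hadj, by simp [hvK, hvP], b, by simpa using hb⟩
      · exact ⟨_, _, fun y => (hmem y).trans or_comm, fun c hc d hd => (hadj d hd c hc).symm,
          by simp [hvK, hvP], a, by simpa [ha] using hPK ha⟩
    · exfalso
      by_cases hvP : v ∈ P
      · exact hb.2 (hfull P hvP hPK (fun x hx y hy hxy => by
          by_contra h
          exact hPQ x hx y ⟨hy, h⟩ hxy) b hbK)
      · exact (hfull (K \ P) ⟨hvK, hvP⟩ (fun y hy => hy.1) (fun x hx y hy hxy =>
          ⟨hy, fun h => hPQ y h x hx hxy.symm⟩) a (hPK ha)).2 ha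
  have hwC : w ∈ C := ((hKCD w).1 hwK).resolve_right fun h => hnvw (hCD v hvC w h)
  obtain ⟨x, hx⟩ := hD
  obtain ⟨Q, hQK, hQ, ⟨p, hp, q, hq, x', hx', hpq, hnpq, hxp, hxq, hdom⟩, r, hr, hrk⟩ :=
    exists_copyOn_hasWitness hT hKCD hCD hvC hwC hx hwv.symm hnvw rfl
      (fun y hy => by
        have := hKn y hy
        have := hv y
        omega) (by omega) (by omega)
  have hzQ : z ∉ Q := fun h => hzK (hQK h)
  refine ⟨Q, hQ, fun R hR => isSuperEdgeConnected_induce hR hzQ ?_ ?_⟩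
  · intro a b _ _ hab hn
    obtain ⟨c, hac, hcb⟩ : ∃ c, c = z ∧ G.Adj a c ∧ G.Adj c b := by
      refine ⟨z, rfl, (hz a ?_).symm, hz b ?_⟩
      · rintro rfl; exact hn (hz b hab.symm)
      · rintro rfl; exact hn (hz a hab).symm
    exact ⟨c, hac ▸ hzQ, hcb⟩
  · intro X hXQ hX2 hXc hmin hXdeg hclique hout
    have hzX : z ∉ X := by
      intro hzX
      have h1 := hout z hzX
      have h2 : Qᶜ \ X ⊆ (nbrs G z \ Q) \ X := by
        intro y hy
        simp only [mem_sdiff, mem_compl, mem_nbrs] at hy ⊢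
        exact ⟨⟨hz y fun h => hy.2 (h ▸ hzX), hy.1⟩, hy.2⟩
      have := card_le_card h2
      omega
    have hXcl : ∀ x ∈ X, ∀ y, y ∉ Q → y ≠ z → G.Adj x y → y ∈ X := by
      intro x hx y hyQ hyz hxy
      by_contra hyX
      refine hyz (card_le_one.1 (hout x hx).le y (by simp [hxy, hyQ, hyX]) z ?_)
      simp only [mem_sdiff, mem_nbrs]
      exact ⟨⟨(hz x fun h => hzX (h ▸ hx)).symm, hzQ⟩, hzX⟩
    have hne : ∀ y ∈ K, y ≠ z := fun y hy h => hzK (h ▸ hy)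
    rw [mem_sdiff] at hp hq hx' hr
    by_cases hXK : ∃ y ∈ X, y ∈ K
    · obtain ⟨y, hyX, hyK⟩ := hXK
      have hyQ := disjoint_left.1 hXQ hyX
      -- Apart from z, X is closed under adjacency in the remaining graph, so domination pulls in
      -- x', and then the non-adjacent p and q.
      have hx'X : x' ∈ X := by
        rcases hdom y (mem_sdiff.2 ⟨hyK, hyQ⟩) with rfl | rfl | h | h
        · exact hXcl _ hyX x' hx'.2 (hne x' hx'.1) hxp.symm
        · exact hXcl _ hyX x' hx'.2 (hne x' hx'.1) hxq.symm
        · exact hXcl p (hXcl y hyX p hp.2 (hne p hp.1) h) x' hx'.2 (hne x' hx'.1) hxp.symm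
        · exact hXcl y hyX x' hx'.2 (hne x' hx'.1) h
      exact hnpq (hclique p (hXcl x' hx'X p hp.2 (hne p hp.1) hxp) q
        (hXcl x' hx'X q hq.2 (hne q hq.1) hxq) hpq)
    · push Not at hXK
      have hXnQ : ∀ a ∈ X, ∀ y, G.Adj a y → y ∉ Q := fun a ha y hay hyQ =>
        hXK a ha (hKcl y (hQK hyQ) a (fun h => hzX (h ▸ ha)) hay.symm)
      -- Away from K no degree has changed, so |X| ≥ δ by `a`, while the degree of r gives |X| ≤ δ.
      -- Thus X contradicts `hnoX`.
      obtain ⟨a, ha⟩ := card_pos.1 (by omega : 0 < X.card)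
      have h1 : nbrs G a \ Q = nbrs G a := sdiff_eq_self_of_disjoint
        (disjoint_left.2 fun y hy => hXnQ a ha y (mem_nbrs.1 hy))
      have h2 := hXdeg a ha
      rw [h1] at h2
      have h3 := hv a
      have h4 : nbrs G r \ Q ⊆ insert z ((nbrs G r ∩ K) \ Q) := by
        intro y hy
        simp only [mem_sdiff, mem_nbrs, mem_insert, mem_inter] at hy ⊢
        by_cases hyz : y = z
        · exact Or.inl hyz
        · exact Or.inr ⟨⟨hy.1, hKcl r hr.1 y hyz hy.1⟩, hy.2⟩
      have h5 := (card_le_card h4).trans (card_insert_le _ _)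
      have h6 := hmin r hr.2
      exact hnoX X v hzX (fun a ha y hyz hay => hXcl a ha y (hXnQ a ha y hay) hyz hay)
        (fun h => hXK v h hvK) hvz (by omega)

/-- If G - z is a join, one of its sides has two vertices and z joins the other. Otherwise G - z is
disconnected. -/
lemma hasSuperRemoval_of_universal {T : SimpleGraph W} (hT : T.IsTree) {G : SimpleGraph V}
    (hsplit : ∀ S : Set V, S.Nontrivial → SplitsAt G S) (hsuper : IsSuperEdgeConnected G)
    (hdeg : ∀ v, Fintype.card W + 2 ≤ (nbrs G v).card)
    (hcard : Fintype.card W + 5 ≤ Fintype.card V) {z : V} (hz : ∀ v, v ≠ z → G.Adj z v) :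
    HasSuperRemoval T G := by
  have hc : (univ.erase z).card = Fintype.card V - 1 := by
    rw [card_erase_of_mem (mem_univ z), card_univ]
  obtain ⟨a, ha, b, hb, hab⟩ := one_lt_card.1 (by omega : 1 < (univ.erase z).card)
  rw [mem_erase] at ha hb
  obtain ⟨P, hPz, ⟨p, hp⟩, ⟨q, hq⟩, hPQ⟩ := hsplit {z}ᶜ ⟨a, ha.1, b, hb.1, hab⟩
  have hpz : p ≠ z := hPz hp
  have hqz : q ≠ z := hq.1
  rcases hPQ with hPQ | hPQ
  · have key : ∀ A B : Finset V, A.Nonempty → (∀ v, v ≠ z → v ∈ A ∨ v ∈ B) → z ∉ A → z ∉ B →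
        (∀ a ∈ A, ∀ b ∈ B, G.Adj a b) → 2 ≤ B.card → HasSuperRemoval T G := by
      intro A B hA hAB hzA hzB hadj hB
      refine IsJoin.hasSuperRemoval hT (A := insert z A) (B := B) ⟨fun v => ?_, fun c hc d hd => ?_⟩
        ?_ hB hdeg hcard
      · by_cases hv : v = z
        · exact Or.inl (by simp [hv])
        · exact (hAB v hv).imp_left mem_insert_of_mem
      · rcases mem_insert.1 hc with rfl | hc
        · exact hz d fun h => hzB (h ▸ hd)
        · exact hadj c hc d hd
      · rw [card_insert_of_notMem hzA]
        have := card_pos.2 hA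
        omega
    let A : Finset V := univ.filter (· ∈ P)
    let B : Finset V := univ.filter (· ∈ ({z}ᶜ \ P : Set V))
    have hzP : z ∉ P := fun h => hPz h rfl
    have hAB : ∀ v, v ≠ z → v ∈ A ∨ v ∈ B := by
      intro v hv
      by_cases h : v ∈ P <;> simp [A, B, h, hv]
    have hzA : z ∉ A := by simp [A, hzP]
    have hzB : z ∉ B := by simp [B]
    have hadj : ∀ a ∈ A, ∀ b ∈ B, G.Adj a b := by
      intro a ha b hb
      exact hPQ a (by simpa [A] using ha) b (by simpa [B] using hb)
    have hsum : (univ.erase z).card ≤ A.card + B.card := by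
      rw [← card_union_of_disjoint (disjoint_left.2 fun a ha hb => (hadj a ha a hb).ne rfl)]
      refine card_le_card fun y hy => ?_
      rw [mem_union]
      exact hAB y (mem_erase.1 hy).1
    rcases le_or_gt 2 B.card with hB | hB
    · exact key A B ⟨p, by simpa [A] using hp⟩ hAB hzA hzB hadj hB
    · exact key B A ⟨q, by simpa [B] using hq⟩ (fun v hv => (hAB v hv).symm) hzB hzA
        (fun a ha b hb => (hadj b hb a ha).symm) (by omega)
  · refine hasSuperRemoval_of_cone hT hsplit hsuper hdeg hz (P₀ := univ.filter (· ∈ P))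
      (p₀ := p) (q₀ := q) ?_ ?_ ?_ ?_ hqz
    · simpa using fun h => hPz h rfl
    · intro x hx y hyz hxy
      simp only [mem_filter, mem_univ, true_and] at hx ⊢
      by_contra h
      exact hPQ x hx y ⟨hyz, h⟩ hxy
    · simpa using hp
    · simpa using hq.2

lemma IsCograph.hasSuperRemoval {T : SimpleGraph W} (hT : T.IsTree) {G : SimpleGraph V}
    (hG : IsCograph G) (hsuper : IsSuperEdgeConnected G) [Nonempty V]
    (hdeg : ∀ v, Fintype.card W + 2 ≤ (nbrs G v).card) : HasSuperRemoval T G := by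
  rcases le_or_gt (Fintype.card V) (Fintype.card W + 4) with hle | hcard
  · exact hasSuperRemoval_of_card_le hT hdeg hle
  have hsplit := hG.splitsAt
  have hconn : G.Preconnected := by
    rcases (isSuperEdgeConnected_iff G).1 hsuper with h | ⟨-, v, hv, -⟩
    · exact h.1.preconnected
    · have h0 : nbrs G v = ∅ := by
        ext y
        simpa using hv y
      have := hdeg v
      simp [h0] at this
  have hnt : Nontrivial V := Fintype.one_lt_card_iff_nontrivial.1 (by omega)
  obtain ⟨P, -, ⟨p, hp⟩, ⟨q, hq⟩, hPQ⟩ := hsplit Set.univ Set.nontrivial_univ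
  rcases hPQ with hPQ | hPQ
  · have hJ : IsJoin G (univ.filter (· ∈ P)) (univ.filter (· ∉ P)) := by
      refine ⟨fun v => ?_, fun a ha b hb => ?_⟩
      · simp only [mem_filter, mem_univ, true_and]
        exact em _
      · simp only [mem_filter, mem_univ, true_and] at ha hb
        exact hPQ a ha b ⟨trivial, hb⟩
    have key : ∀ A B : Finset V, IsJoin G A B → A.Nonempty → A.card < 2 → HasSuperRemoval T G := by
      intro A B h hA hlt
      have := card_pos.2 hA
      obtain ⟨z, rfl⟩ := card_eq_one.1 (by omega : A.card = 1)
      refine hasSuperRemoval_of_universal hT hsplit hsuper hdeg hcard (z := z) fun v hv => ?_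
      exact h.adj z (mem_singleton_self z) v ((h.cover v).resolve_left (by simpa using hv))
    rcases le_or_gt 2 (univ.filter (· ∈ P)).card with hA | hA
    · rcases le_or_gt 2 (univ.filter (· ∉ P)).card with hB | hB
      · exact hJ.hasSuperRemoval hT hA hB hdeg hcard
      · exact key _ _ hJ.symm ⟨q, by simpa using hq⟩ hB
    · exact key _ _ hJ ⟨p, by simpa using hp⟩ hA
  · refine absurd hconn (not_preconnected_of_closed (X := P) (fun x hx y hxy => ?_) hp hq.2)
    by_contra h
    exact hPQ x hx y ⟨trivial, h⟩ hxy

end Cone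

/-! ### Tightness: the cone over two cocktail party graphs -/

section Tightness

open Finset
open scoped Classical

universe v

lemma starOfOrder_eq (m : ℕ) (hm : 0 < m) :
    starOfOrder m = SimpleGraph.starGraph (⟨0, hm⟩ : Fin m) := by
  ext x y
  simp [starOfOrder, SimpleGraph.fromRel_adj, Fin.ext_iff]

lemma starOfOrder_isTree (m : ℕ) (hm : 0 < m) : (starOfOrder m).IsTree := by
  rw [starOfOrder_eq m hm]
  exact SimpleGraph.isTree_starGraph _

variable {V : Type v}

lemma exists_center_of_iso_star {m : ℕ} (hm : 0 < m) {G : SimpleGraph V} {T' : G.Subgraph}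
    (e : T'.coe ≃g starOfOrder m) :
    T'.verts.ncard = m ∧ ∃ c ∈ T'.verts, ∀ y ∈ T'.verts, y ≠ c → G.Adj c y := by
  refine ⟨?_, e.symm ⟨0, hm⟩, (e.symm ⟨0, hm⟩).2, fun y hy hyc => ?_⟩
  · rw [← Nat.card_coe_set_eq, Nat.card_congr e.toEquiv, Nat.card_fin]
  · refine T'.adj_sub (?_ : T'.coe.Adj (e.symm ⟨0, hm⟩) ⟨y, hy⟩)
    rw [← e.map_adj_iff, e.apply_symm_apply]
    have hs := congrArg (fun H => H.Adj ⟨0, hm⟩ (e ⟨y, hy⟩)) (starOfOrder_eq m hm)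
    refine hs.mpr (SimpleGraph.starGraph_center_adj fun h => hyc ?_)
    rw [h, e.symm_apply_apply]

variable [Fintype V]

/-- `G` is the join of the single vertex `z` and two disjoint cocktail party graphs on `m + 2`
vertices each, where `σ` exchanges non-adjacent vertices and `side` tells the two apart. -/
structure IsDoubleCocktailCone (G : SimpleGraph V) (z : V) (side : V → Bool) (σ : V → V) (m : ℕ) :
    Prop where
  adj_iff : ∀ u v, G.Adj u v ↔ u ≠ v ∧ (u = z ∨ v = z ∨ (side u = side v ∧ v ≠ σ u))
  invol : ∀ u, σ (σ u) = u
  ne_self : ∀ u, u ≠ z → σ u ≠ u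
  ne_apex : ∀ u, u ≠ z → σ u ≠ z
  side_eq : ∀ u, side (σ u) = side u
  card_side : ∀ b, (univ.filter fun u => u ≠ z ∧ side u = b).card = m + 2

namespace IsDoubleCocktailCone

variable {G : SimpleGraph V} {z : V} {side : V → Bool} {σ : V → V} {m : ℕ}

lemma adj_apex (h : IsDoubleCocktailCone G z side σ m) : ∀ v, v ≠ z → G.Adj z v :=
  fun v hv => (h.adj_iff z v).2 ⟨hv.symm, Or.inl rfl⟩

lemma adj_of_ne (h : IsDoubleCocktailCone G z side σ m) {u v : V} (huv : u ≠ v)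
    (hs : side u = side v) (hσ : v ≠ σ u) : G.Adj u v :=
  (h.adj_iff u v).2 ⟨huv, Or.inr (Or.inr ⟨hs, hσ⟩)⟩

lemma of_adj (h : IsDoubleCocktailCone G z side σ m) {u v : V} (hu : u ≠ z) (hv : v ≠ z)
    (huv : G.Adj u v) : side u = side v ∧ v ≠ σ u :=
  (((h.adj_iff u v).1 huv).2.resolve_left hu).resolve_left hv

lemma exists_ne (h : IsDoubleCocktailCone G z side σ m) (hm : 2 ≤ m) (u : V) (b : Bool) :
    ∃ w, w ≠ z ∧ side w = b ∧ w ≠ u ∧ w ≠ σ u := by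
  have h1 := le_card_sdiff ({u, σ u} : Finset V) (univ.filter fun u => u ≠ z ∧ side u = b)
  have h2 : ({u, σ u} : Finset V).card ≤ 2 := card_le_two
  rw [h.card_side b] at h1
  obtain ⟨w, hw⟩ := card_pos.1 (by omega :
    0 < ((univ.filter fun u => u ≠ z ∧ side u = b) \ {u, σ u}).card)
  simp only [mem_sdiff, mem_filter, mem_univ, true_and, mem_insert, mem_singleton, not_or] at hw
  exact ⟨w, hw.1.1, hw.1.2, hw.2.1, hw.2.2⟩

lemma card_nbrs (h : IsDoubleCocktailCone G z side σ m) {u : V} (hu : u ≠ z) :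
    (nbrs G u).card = m + 1 := by
  have h1 : nbrs G u =
      insert z (((univ.filter fun w => w ≠ z ∧ side w = side u).erase u).erase (σ u)) := by
    ext w
    simp only [mem_nbrs, mem_insert, mem_erase, mem_filter, mem_univ, true_and]
    by_cases hw : w = z
    · subst hw
      simp [(h.adj_apex u hu).symm]
    · constructor
      · intro huw
        have := h.of_adj hu hw huw
        exact Or.inr ⟨this.2, huw.ne', hw, this.1.symm⟩
      · rintro (h1 | ⟨h1, h2, -, h3⟩)
        · exact absurd h1 hw
        · exact h.adj_of_ne (Ne.symm h2) h3.symm h1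
  rw [h1, card_insert_of_notMem (by simp), card_erase_of_mem, card_erase_of_mem, h.card_side]
  · omega
  · simp [hu]
  · simp [h.ne_self u hu, h.ne_apex u hu, h.side_eq]

lemma lt_card_nbrs_apex (h : IsDoubleCocktailCone G z side σ m) : m + 2 ≤ (nbrs G z).card := by
  rw [← h.card_side true]
  refine card_le_card fun u hu => ?_
  simp only [mem_filter, mem_univ, true_and] at hu
  exact mem_nbrs.2 (h.adj_apex u hu.1)

lemma le_card_nbrs (h : IsDoubleCocktailCone G z side σ m) (u : V) : m + 1 ≤ (nbrs G u).card := by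
  by_cases hu : u = z
  · have := h.lt_card_nbrs_apex
    rw [hu]
    omega
  · exact (h.card_nbrs hu).ge

/-- Split off the apex, then separate the two sides, then a pair of opposite vertices, and finally
that pair itself. -/
lemma splitsAt (h : IsDoubleCocktailCone G z side σ m) (S : Set V) (hS : S.Nontrivial) :
    SplitsAt G S := by
  by_cases hz : z ∈ S
  · obtain ⟨y, hy, hyz⟩ := hS.exists_ne z
    refine ⟨{z}, by simpa using hz, ⟨z, rfl⟩, ⟨y, hy, hyz⟩, Or.inl ?_⟩
    rintro _ rfl q hq
    exact h.adj_apex q hq.2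
  have hne : ∀ y ∈ S, y ≠ z := fun y hy hyz => hz (hyz ▸ hy)
  obtain ⟨a, ha, b, hb, hab⟩ := hS
  by_cases hside : ∃ y ∈ S, side y ≠ side a
  · obtain ⟨y, hy, hya⟩ := hside
    refine ⟨{x | x ∈ S ∧ side x = side a}, fun x hx => hx.1, ⟨a, ha, rfl⟩,
      ⟨y, hy, fun hy => hya hy.2⟩, Or.inr fun p hp q hq hpq => ?_⟩
    refine hq.2 ⟨hq.1, ?_⟩
    rw [← (h.of_adj (hne p hp.1) (hne q hq.1) hpq).1, hp.2]
  push Not at hside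
  by_cases hall : ∃ y ∈ S, y ≠ a ∧ y ≠ σ a
  · obtain ⟨y, hy, hya, hyσ⟩ := hall
    refine ⟨{x | x ∈ S ∧ (x = a ∨ x = σ a)}, fun x hx => hx.1, ⟨a, ha, Or.inl rfl⟩,
      ⟨y, hy, fun hy => hy.2.elim hya hyσ⟩, Or.inl fun p hp q hq => ?_⟩
    have hqn : q ≠ a ∧ q ≠ σ a := by
      constructor
      · exact fun hqa => hq.2 ⟨hq.1, Or.inl hqa⟩
      · exact fun hqa => hq.2 ⟨hq.1, Or.inr hqa⟩
    refine h.adj_of_ne ?_ ((hside p hp.1).trans (hside q hq.1).symm) ?_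
    · rintro rfl
      exact hp.2.elim hqn.1 hqn.2
    · rcases hp.2 with rfl | rfl
      · exact hqn.2
      · rw [h.invol]
        exact hqn.1
  · push Not at hall
    refine ⟨{a}, by simpa using ha, ⟨a, rfl⟩, ⟨b, hb, hab.symm⟩, Or.inr ?_⟩
    rintro _ rfl q hq hpq
    exact (h.of_adj (hne _ ha) (hne q hq.1) hpq).2 (hall q hq.1 hq.2)

lemma isCograph (h : IsDoubleCocktailCone G z side σ m) : IsCograph G :=
  have : Nonempty V := ⟨z⟩
  IsCograph.of_splitsAt h.splitsAt

/-- A bad set avoids the apex, whose degree is too large. It therefore absorbs all other neighbours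
of each of its vertices, among them a pair w, σ w, so it is no clique. -/
lemma isSuperEdgeConnected (h : IsDoubleCocktailCone G z side σ m) (hm : 2 ≤ m) :
    IsSuperEdgeConnected G := by
  have : Nonempty V := ⟨z⟩
  refine (diamLeTwo_of_universal h.adj_apex).isSuperEdgeConnected fun X hX => ?_
  obtain ⟨u, hu, -⟩ := h.exists_ne hm z true
  have hcard : X.card ≤ m + 1 := (hX.le_card_nbrs u).trans (h.card_nbrs hu).le
  have hzX : z ∉ X := fun hz => by
    have := hX.card_nbrs_eq z hz
    have := h.lt_card_nbrs_apex
    omega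
  have hne : ∀ y ∈ X, y ≠ z := fun y hy hyz => hzX (hyz ▸ hy)
  obtain ⟨x, hx⟩ := card_pos.1 (by have := hX.two_le; omega : 0 < X.card)
  have hxz := hne x hx
  have hin : ∀ w, w ≠ z → G.Adj x w → w ∈ X := by
    intro w hw hxw
    by_contra hwX
    refine hw (card_le_one.1 (hX.card_out x hx).le w (by simp [hxw, hwX]) z ?_)
    simp [(h.adj_apex x hxz).symm, hzX]
  obtain ⟨w, hwz, hws, hwx, hwσ⟩ := h.exists_ne hm x (side x)
  have h1 := hin w hwz (h.adj_of_ne hwx.symm hws.symm hwσ)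
  have h2 := hin (σ w) (h.ne_apex w hwz) (h.adj_of_ne (fun hc => hwσ (by rw [hc, h.invol]))
    (by rw [h.side_eq, hws]) (fun hc => hwx (by rw [← h.invol w, hc, h.invol])))
  exact (h.of_adj hwz (h.ne_apex w hwz) (hX.adj w h1 _ h2 (h.ne_self w hwz).symm)).2 rfl

/-- If z is removed, the sides separate, and every remaining vertex keeps one of its m + 1
neighbours. If not, P lies on the side of its centre c, where just σ c and one more vertex x
survive; they are adjacent, and z is their only other neighbour. -/
lemma not_isSuperEdgeConnected_induce (h : IsDoubleCocktailCone G z side σ m) (hm : 2 ≤ m)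
    {R : Set V} {P : Finset V} (hR : ∀ v, v ∈ R ↔ v ∉ P) (hP : P.card = m) {c : V} (hc : c ∈ P)
    (hcP : ∀ y ∈ P, y ≠ c → G.Adj c y) : ¬ IsSuperEdgeConnected (G.induce R) := by
  by_cases hz : z ∈ P
  · have hRz : ∀ v ∈ R, v ≠ z := fun v hv hvz => (hR v).1 hv (hvz ▸ hz)
    have hex : ∀ b, ∃ w, w ∈ R ∧ side w = b := by
      intro b
      have h1 := le_card_sdiff P (univ.filter fun u => u ≠ z ∧ side u = b)
      rw [h.card_side b, hP] at h1
      obtain ⟨w, hw⟩ := card_pos.1 (by omega :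
        0 < ((univ.filter fun u => u ≠ z ∧ side u = b) \ P).card)
      simp only [mem_sdiff, mem_filter, mem_univ, true_and] at hw
      exact ⟨w, (hR w).2 hw.2, hw.1.2⟩
    obtain ⟨a, ha, has⟩ := hex true
    obtain ⟨b, hb, hbs⟩ := hex false
    have hnc : ¬ (G.induce R).Preconnected := by
      refine not_preconnected_of_closed (X := {u | side u = true}) (a := ⟨a, ha⟩) (b := ⟨b, hb⟩)
        (fun x hx y hxy => ?_) has (by simp [hbs])
      exact ((h.of_adj (hRz x x.2) (hRz y y.2) hxy).1).symm.trans hx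
    rw [isSuperEdgeConnected_iff]
    rintro (⟨hconn, -⟩ | ⟨-, ⟨u, hu⟩, hiso, -⟩)
    · exact hnc hconn.preconnected
    · have huz := hRz u hu
      have h1 := card_nbrs_sdiff_add G u P
      rw [h.card_nbrs huz, hP] at h1
      obtain ⟨y, hy⟩ := card_pos.1 (by omega : 0 < (nbrs G u \ P).card)
      rw [mem_sdiff, mem_nbrs] at hy
      exact hiso ⟨y, (hR y).2 hy.2⟩ hy.1
  · have hPz : ∀ y ∈ P, y ≠ z := fun y hy hyz => hz (hyz ▸ hy)
    have hcz := hPz c hc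
    obtain ⟨B, hB⟩ : ∃ B, B = univ.filter fun u => u ≠ z ∧ side u = side c := ⟨_, rfl⟩
    have hBmem : ∀ u, u ∈ B ↔ u ≠ z ∧ side u = side c := by simp [hB]
    have hPB : P ⊆ B := by
      intro y hy
      rw [hBmem]
      refine ⟨hPz y hy, ?_⟩
      by_cases hyc : y = c
      · rw [hyc]
      · exact (h.of_adj hcz (hPz y hy) (hcP y hy hyc)).1.symm
    have hσP : σ c ∉ P := fun hσ =>
      (h.of_adj hcz (h.ne_apex c hcz) (hcP _ hσ (h.ne_self c hcz))).2 rfl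
    have hσB : σ c ∈ B \ P := by
      rw [mem_sdiff, hBmem]
      exact ⟨⟨h.ne_apex c hcz, h.side_eq c⟩, hσP⟩
    have hcard : ((B \ P).erase (σ c)).card = 1 := by
      rw [card_erase_of_mem hσB]
      have h1 := card_sdiff_add_card_eq_card hPB
      rw [hP, hB, h.card_side] at h1
      rw [hB]
      omega
    obtain ⟨x, hx⟩ := card_eq_one.1 hcard
    have hxB : x ∈ (B \ P).erase (σ c) := by rw [hx]; exact mem_singleton_self x
    rw [mem_erase, mem_sdiff, hBmem] at hxB
    obtain ⟨hxσ, ⟨hxz, hxs⟩, hxP⟩ := hxB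
    have honly : ∀ y, y ∉ P → y ≠ z → side y = side c → y = σ c ∨ y = x := by
      intro y hy hyz hys
      by_cases hyσ : y = σ c
      · exact Or.inl hyσ
      · right
        rw [← mem_singleton, ← hx, mem_erase, mem_sdiff, hBmem]
        exact ⟨hyσ, ⟨hyz, hys⟩, hy⟩
    have hσz := h.ne_apex c hcz
    have hσx : G.Adj (σ c) x := by
      refine h.adj_of_ne hxσ.symm (by rw [h.side_eq, hxs]) ?_
      rw [h.invol]
      rintro rfl
      exact hxP hc
    obtain ⟨w, hwz, hws, -⟩ := h.exists_ne hm z (!side c)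
    have hwP : ∀ y, side y = !side c → y ∉ P := by
      intro y hys hy
      have := ((hBmem y).1 (hPB hy)).2
      rw [hys] at this
      simp at this
    let z' : R := ⟨z, (hR z).2 hz⟩
    let s' : R := ⟨σ c, (hR _).2 hσP⟩
    let x' : R := ⟨x, (hR x).2 hxP⟩
    let w' : R := ⟨w, (hR w).2 (hwP w hws)⟩
    have hsx' : s' ≠ x' := fun e => hxσ (congrArg Subtype.val e).symm
    have hsz' : s' ≠ z' := fun e => hσz (congrArg Subtype.val e)
    have hxz' : x' ≠ z' := fun e => hxz (congrArg Subtype.val e)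
    have hwz' : w' ≠ z' := fun e => hwz (congrArg Subtype.val e)
    have hwne : ∀ y : V, side y = side c → w ≠ y := by
      rintro y hy rfl
      rw [hws] at hy
      simp at hy
    have huniv : ∀ v : R, v ≠ z' → (G.induce R).Adj z' v := fun v hv =>
      h.adj_apex v fun e => hv (Subtype.ext e)
    have hcase : ∀ v : R, v = z' ∨ v = s' ∨ v = x' ∨ (v.1 ≠ z ∧ side v.1 = !side c) := by
      rintro ⟨v, hv⟩
      by_cases hvz : v = z
      · exact Or.inl (Subtype.ext hvz)
      by_cases hvs : side v = side c
      · rcases honly v ((hR v).1 hv) hvz hvs with e | e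
        · exact Or.inr (Or.inl (Subtype.ext e))
        · exact Or.inr (Or.inr (Or.inl (Subtype.ext e)))
      · exact Or.inr (Or.inr (Or.inr ⟨hvz, by simpa [Bool.eq_not_iff] using hvs⟩))
    have hpair : ({s', x'} : Finset R).card = 2 := card_pair hsx'
    refine not_isSuperEdgeConnected_of_universal (z := z') (w := w') huniv (X := {s', x'}) ?_ ?_ ?_
      hwz' hpair.ge ?_
    · simp [hsz'.symm, hxz'.symm]
    · intro y hy u hyu
      have hys : y.1 ≠ z ∧ side y.1 = side c := by
        rw [mem_insert, mem_singleton] at hy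
        rcases hy with rfl | rfl
        · exact ⟨hσz, h.side_eq c⟩
        · exact ⟨hxz, hxs⟩
      rcases hcase u with e | e | e | ⟨hu, hus⟩
      · exact Or.inr e
      · exact Or.inl (by simp [e])
      · exact Or.inl (by simp [e])
      · have := (h.of_adj hys.1 hu hyu).1
        rw [hys.2, hus] at this
        simp at this
    · rw [mem_insert, mem_singleton, not_or]
      exact ⟨fun e => hwne _ (h.side_eq c) (congrArg Subtype.val e),
        fun e => hwne _ hxs (congrArg Subtype.val e)⟩
    · intro u
      rw [hpair]
      apply one_lt_card.2
      rcases hcase u with e | e | e | ⟨hu, hus⟩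
      · exact ⟨s', by simpa [e] using huniv s' hsz', x', by simpa [e] using huniv x' hxz', hsx'⟩
      · exact ⟨z', by simpa [e] using (huniv s' hsz').symm, x', mem_nbrs.2 (e ▸ hσx), hxz'.symm⟩
      · exact ⟨z', by simpa [e] using (huniv x' hxz').symm, s', mem_nbrs.2 (e ▸ hσx.symm),
          hsz'.symm⟩
      · obtain ⟨y, hyz, hys, hyu, hyσ⟩ := h.exists_ne hm u.1 (!side c)
        refine ⟨z', mem_nbrs.2 (huniv u fun e => hu (congrArg Subtype.val e)).symm,
          ⟨y, (hR y).2 (hwP y hys)⟩, mem_nbrs.2 ?_, fun e => hyz (congrArg Subtype.val e).symm⟩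
        exact h.adj_of_ne (Ne.symm hyu) (hus.trans hys.symm) hyσ

end IsDoubleCocktailCone

lemma exists_isDoubleCocktailCone (k : ℕ) : ∃ (n : ℕ) (G : SimpleGraph (Fin n)) (z : Fin n)
    (side : Fin n → Bool) (σ : Fin n → Fin n), IsDoubleCocktailCone G z side σ (2 * k) := by
  -- `none` is the apex; a triple records the side, the index of the opposite pair and the end of
  -- that pair, giving 2(k + 1) = m + 2 vertices per side. The side assigned to the apex is
  -- immaterial.
  let e := (Fintype.equivFin (Option (Bool × Fin (k + 1) × Bool))).symm
  let side : Option (Bool × Fin (k + 1) × Bool) → Bool := fun u => u.elim true fun p => p.1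
  let σ : Option (Bool × Fin (k + 1) × Bool) → Option (Bool × Fin (k + 1) × Bool) := Option.map fun p => (p.1, p.2.1, !p.2.2)
  have hσσ : ∀ u, σ (σ u) = u := by rintro (_ | u) <;> simp [σ]
  have hσside : ∀ u, side (σ u) = side u := by rintro (_ | u) <;> simp [σ, side]
  let G : SimpleGraph (Option (Bool × Fin (k + 1) × Bool)) :=
    { Adj := fun u v => u ≠ v ∧ (u = none ∨ v = none ∨ (side u = side v ∧ v ≠ σ u))
      symm := ⟨fun u v h => ⟨h.1.symm, by
        rcases h.2 with h | h | h
        · exact Or.inr (Or.inl h)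
        · exact Or.inl h
        · exact Or.inr (Or.inr ⟨h.1.symm, fun e => h.2 (by rw [e, hσσ])⟩)⟩⟩
      loopless := ⟨fun u h => h.1 rfl⟩ }
  have hz : ∀ u, u = e.symm none ↔ e u = none := fun u => e.eq_symm_apply
  refine ⟨_, G.comap e, e.symm none, fun u => side (e u), fun u => e.symm (σ (e u)),
    ?_, ?_, ?_, ?_, ?_, ?_⟩
  · intro u v
    rw [SimpleGraph.comap_adj, hz, hz, Ne, Ne, e.eq_symm_apply, ← e.injective.eq_iff]
  · intro u
    simp [hσσ]
  · intro u hu h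
    rw [Ne, hz] at hu
    rw [e.symm_apply_eq] at h
    rcases hu' : e u with _ | ⟨a, b, c⟩
    · exact hu hu'
    · rw [hu'] at h
      simp [σ] at h
  · intro u hu h
    rw [Ne, hz] at hu
    rw [e.symm.injective.eq_iff] at h
    rcases hu' : e u with _ | p
    · exact hu hu'
    · rw [hu'] at h
      simp [σ] at h
  · intro u
    simp [hσside]
  · intro b
    trans ((univ : Finset (Fin (k + 1) × Bool)).image fun p => e.symm (some (b, p))).card
    · congr 1
      ext u
      simp only [mem_filter, mem_univ, true_and, mem_image, ne_eq, hz, e.symm_apply_eq]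
      rcases e u with _ | ⟨a, p⟩
      · simp
      · simp [side, eq_comm]
    · rw [card_image_of_injective]
      · simp
        ring
      · intro p q h
        simpa using h

end Tightness

theorem mainTheorem11 :
    (∀ {W : Type*} [Fintype W] (T : SimpleGraph W) (m : ℕ), T.IsTree → Fintype.card W = m →
      ∀ {V : Type*} [Fintype V] (G : SimpleGraph V) [DecidableRel G.Adj],
        IsCograph G → IsSuperEdgeConnected G → m + 2 ≤ G.minDegree →
        ∃ T' : G.Subgraph, Nonempty (T'.coe ≃g T) ∧
          IsSuperEdgeConnected (G.induce (T'.verts)ᶜ)) ∧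
    (∀ m : ℕ, 0 < m → Even m → (starOfOrder m).IsTree ∧
      ∃ (n : ℕ) (G : SimpleGraph (Fin n)) (_ : DecidableRel G.Adj),
        IsCograph G ∧ IsSuperEdgeConnected G ∧ G.minDegree = m + 1 ∧
        ∀ T' : G.Subgraph, Nonempty (T'.coe ≃g starOfOrder m) →
          ¬ IsSuperEdgeConnected (G.induce (T'.verts)ᶜ)) := by
  refine ⟨?_, ?_⟩
  · intro W _ T m hT hW V _ G _ hG hsuper hdeg
    subst hW
    -- On the empty graph `minDegree` is 0 by convention, contrary to the bound.
    have hV : Nonempty V := by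
      by_contra h
      rw [not_nonempty_iff] at h
      rw [G.minDegree_of_subsingleton] at hdeg
      omega
    obtain ⟨P, hP, hPR⟩ := hG.hasSuperRemoval hT hsuper fun v =>
      hdeg.trans (minDegree_le_card_nbrs G v)
    obtain ⟨T', hT', hverts⟩ := hP.exists_subgraph
    exact ⟨T', hT', hPR _ fun v => by simp [hverts]⟩
  · intro m hm hev
    refine ⟨starOfOrder_isTree m hm, ?_⟩
    obtain ⟨k, rfl⟩ := hev.two_dvd
    obtain ⟨n, G, z, side, σ, h⟩ := exists_isDoubleCocktailCone k
    classical
    refine ⟨n, G, inferInstance, h.isCograph, h.isSuperEdgeConnected (by omega), ?_, ?_⟩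
    · have : Nonempty (Fin n) := ⟨z⟩
      obtain ⟨u, hu, -⟩ := h.exists_ne (by omega) z true
      refine le_antisymm ((minDegree_le_card_nbrs G u).trans (h.card_nbrs hu).le) ?_
      obtain ⟨v, hv⟩ := exists_card_nbrs_eq_minDegree G
      rw [← hv]
      exact h.le_card_nbrs v
    · rintro T' ⟨e⟩
      obtain ⟨hcard, c, hc, hcadj⟩ := exists_center_of_iso_star hm e
      refine h.not_isSuperEdgeConnected_induce (by omega) (P := T'.verts.toFinset)
        (fun v => by simp) ?_ (by simpa using hc) (fun y hy => hcadj y (by simpa using hy))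
      rw [← hcard, Set.ncard_eq_toFinset_card']
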